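/- Let $d\in\mathbb{N}$ and fix a step size $\Delta t>0$. Let $\mu:\mathbb{R}^d\to\mathbb{R}^d$ be a function (the drift), let $\sigma:\mathbb{R}^d\to\mathbb{R}^{d\times d}$ be measurable (the volatility), and for $i=1,\dots,d$ let $p_i:\mathbb{R}^d\times\mathbb{R}^d\to(0,1)$ be measurable. The skew-symmetric scheme is the Markov chain on $\mathbb{R}^d$ whose transition from $X^n=x$ to $X^{n+1}$ is as follows: draw $\nu=(\nu_1,\dots,\nu_d)\sim N(0,I_d)$; given $\nu$, draw independent signs $b_1,\dots,b_d$ with $b_i=+1$ with probability $p_i(x,\nu)$ and $b_i=-1$ otherwise; set $$X^{n+1}=x+\Delta t^{1/2}\,\sigma(x)\,(b_1\nu_1,\dots,b_d\nu_d)^{T}.$$ Let $P$ be its Markov kernel and $P^n$ the $n$-step kernel. Write $\|\cdot\|$ for the Euclidean norm and $\|\cdot\|_\infty$ for the supremum norm on $\mathbb{R}^d$. Assume: 1. $\sigma_{i,j}(x)=0$ for all $i\neq j$ and $x\in\mathbb{R}^d$. 2. There are $M>N>0$ such that $N\le\sigma_{i,i}(x)\le M$ for all $i$ and all $x\in\mathbb{R}^d$.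 3. For every $i$, $$\lim_{\substack{\|x\|\to\infty\\ x_i<-\|x\|_\infty/2}}\mu_i(x)=+\infty,\qquad \lim_{\substack{\|x\|\to\infty\\ x_i>\|x\|_\infty/2}}\mu_i(x)=-\infty.$$ 4. For every $i$, there is a function $g_i:\mathbb{R}^d\times\mathbb{R}\to(0,1)$ with $p_i(x,\nu)=g_i(x,\nu_i)$ for all $x,\nu\in\mathbb{R}^d$; $g_i$ is bounded away from zero on compact subsets of $\mathbb{R}^d\times\mathbb{R}$; and, as $(x,t)$ ranges over $\mathbb{R}^d\times\mathbb{R}$, $$\lim_{t\,\mu_i(x)\to+\infty}g_i(x,t)=1,\qquad \lim_{t\,\mu_i(x)\to-\infty}g_i(x,t)=0.$$ Then the chain has an invariant probability measure $\pi_{\Delta t}$ with finite moments of all orders, i.e. $\int\|x\|^k\,\pi_{\Delta t}(dx)<\infty$ for all $k\in\mathbb{N}$, and there exist $C>0$, $\lambda>0$ and a function $V:\mathbb{R}^d\to[1,\infty)$ such that for all $n\in\mathbb{N}$ and $x\in\mathbb{R}^d$ $$\|P^n(x,\cdot)-\pi_{\Delta t}\|_{TV}\le C\,V(x)\,e^{-\lambda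 n},$$ where $\|\cdot\|_{TV}$ is the total variation norm. -/

import Mathlib

open MeasureTheory ProbabilityTheory

namespace SkewSymmetric

/-- The supremum norm on `ℝ^d` (`‖x‖` itself is the Euclidean norm). -/
noncomputable def supNorm {d : ℕ} (x : EuclideanSpace ℝ (Fin d)) : ℝ :=
  ‖(WithLp.ofLp x : Fin d → ℝ)‖

/-- Conditional law of the sign vector `b = (b_1, …, b_d)` given the current state `x` and the
Gaussian vector `ν`: the `b_i` are independent, `b_i = 1` with probability `p_i(x, ν)` and
`b_i = -1` otherwise. -/
noncomputable def flipLaw {d : ℕ}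
    (p : Fin d → EuclideanSpace ℝ (Fin d) → EuclideanSpace ℝ (Fin d) → unitInterval)
    (x ν : EuclideanSpace ℝ (Fin d)) : Measure (Fin d → ℝ) :=
  Measure.pi fun i => bernoulliMeasure (1 : ℝ) (-1) (p i x ν)

instance instIsProbabilityMeasureFlipLaw {d : ℕ}
    (p : Fin d → EuclideanSpace ℝ (Fin d) → EuclideanSpace ℝ (Fin d) → unitInterval)
    (x ν : EuclideanSpace ℝ (Fin d)) : IsProbabilityMeasure (flipLaw p x ν) := by
  unfold flipLaw; infer_instance

/-- The update `x + Δt^{1/2} σ(x) (b ∗ ν)`, with `∗` the element-wise product. -/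
noncomputable def update {d : ℕ} (Δt : ℝ)
    (σ : EuclideanSpace ℝ (Fin d) → Matrix (Fin d) (Fin d) ℝ)
    (x ν : EuclideanSpace ℝ (Fin d)) (b : Fin d → ℝ) : EuclideanSpace ℝ (Fin d) :=
  x + √Δt • WithLp.toLp 2 ((σ x).mulVec fun i => b i * ν i)

/-- Law of `X^{n+1}` given `X^n = x`: draw `ν ∼ N(0, I_d)`, then the signs `b` given `(x, ν)`,
then apply the update. -/
noncomputable def stepLaw {d : ℕ} (Δt : ℝ)
    (σ : EuclideanSpace ℝ (Fin d) → Matrix (Fin d) (Fin d) ℝ)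
    (p : Fin d → EuclideanSpace ℝ (Fin d) → EuclideanSpace ℝ (Fin d) → unitInterval)
    (x : EuclideanSpace ℝ (Fin d)) : Measure (EuclideanSpace ℝ (Fin d)) :=
  (stdGaussian (EuclideanSpace ℝ (Fin d))).bind fun ν => (flipLaw p x ν).map (update Δt σ x ν)

theorem measurable_flipLaw {d : ℕ}
    {p : Fin d → EuclideanSpace ℝ (Fin d) → EuclideanSpace ℝ (Fin d) → unitInterval}
    (hp : ∀ i, Measurable fun z : EuclideanSpace ℝ (Fin d) × EuclideanSpace ℝ (Fin d) =>
      p i z.1 z.2) :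
    Measurable fun z : EuclideanSpace ℝ (Fin d) × EuclideanSpace ℝ (Fin d) =>
      flipLaw p z.1 z.2 := by
  refine Measurable.measure_of_isPiSystem_of_isProbabilityMeasure generateFrom_pi.symm
    isPiSystem_pi ?_
  rintro _ ⟨s, hs, rfl⟩
  simp only [flipLaw, Measure.pi_pi]
  refine Finset.measurable_prod _ fun i _ => ?_
  have h1 : Measurable fun z : EuclideanSpace ℝ (Fin d) × EuclideanSpace ℝ (Fin d) =>
      ENNReal.ofReal (p i z.1 z.2 : ℝ) := by have := hp i; fun_prop
  have h2 : Measurable fun z : EuclideanSpace ℝ (Fin d) × EuclideanSpace ℝ (Fin d) =>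
      ENNReal.ofReal (1 - (p i z.1 z.2 : ℝ)) := by have := hp i; fun_prop
  have h3 : ∀ q : unitInterval, bernoulliMeasure (1 : ℝ) (-1) q (s i)
      = ENNReal.ofReal (q : ℝ) * Measure.dirac (1 : ℝ) (s i)
        + ENNReal.ofReal (1 - (q : ℝ)) * Measure.dirac (-1 : ℝ) (s i) := by
    intro q
    have e1 : ((unitInterval.toNNReal q : NNReal) : ENNReal) = ENNReal.ofReal (q : ℝ) := by
      rw [ENNReal.ofReal, ENNReal.coe_inj]; ext; simp [q.2.1]
    have e2 : ((unitInterval.toNNReal (unitInterval.symm q) : NNReal) : ENNReal)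
        = ENNReal.ofReal (1 - (q : ℝ)) := by
      rw [ENNReal.ofReal, ENNReal.coe_inj]; ext; simp [q.2.2]
    rw [bernoulliMeasure_def, Measure.add_apply, Measure.smul_apply, Measure.smul_apply,
      ENNReal.smul_def, ENNReal.smul_def, e1, e2, smul_eq_mul, smul_eq_mul]
  simp only [h3]
  fun_prop

theorem measurable_update {d : ℕ} (Δt : ℝ)
    {σ : EuclideanSpace ℝ (Fin d) → Matrix (Fin d) (Fin d) ℝ}
    (hσ : ∀ i j, Measurable fun x => σ x i j) :
    Measurable fun z : (EuclideanSpace ℝ (Fin d) × EuclideanSpace ℝ (Fin d)) × (Fin d → ℝ) =>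
      update Δt σ z.1.1 z.1.2 z.2 := by
  unfold update
  have h : Measurable fun z :
      (EuclideanSpace ℝ (Fin d) × EuclideanSpace ℝ (Fin d)) × (Fin d → ℝ) =>
      (σ z.1.1).mulVec fun i => z.2 i * z.1.2 i := by
    refine measurable_pi_lambda _ fun i => ?_
    simp only [Matrix.mulVec, dotProduct]
    refine Finset.measurable_sum _ fun j _ => ?_
    have := (hσ i j).comp (measurable_fst.comp measurable_fst :
      Measurable fun z : (EuclideanSpace ℝ (Fin d) × EuclideanSpace ℝ (Fin d)) × (Fin d → ℝ) =>
        z.1.1)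
    simp only [Function.comp_def] at this
    fun_prop
  fun_prop

theorem measurable_map_flipLaw {d : ℕ} (Δt : ℝ)
    {σ : EuclideanSpace ℝ (Fin d) → Matrix (Fin d) (Fin d) ℝ}
    {p : Fin d → EuclideanSpace ℝ (Fin d) → EuclideanSpace ℝ (Fin d) → unitInterval}
    (hσ : ∀ i j, Measurable fun x => σ x i j)
    (hp : ∀ i, Measurable fun z : EuclideanSpace ℝ (Fin d) × EuclideanSpace ℝ (Fin d) =>
      p i z.1 z.2) :
    Measurable fun z : EuclideanSpace ℝ (Fin d) × EuclideanSpace ℝ (Fin d) =>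
      (flipLaw p z.1 z.2).map (update Δt σ z.1 z.2) := by
  let κ : Kernel (EuclideanSpace ℝ (Fin d) × EuclideanSpace ℝ (Fin d)) (Fin d → ℝ) :=
    ⟨fun z => flipLaw p z.1 z.2, measurable_flipLaw hp⟩
  have hκ : IsMarkovKernel κ := 
    ⟨fun z => inferInstanceAs (IsProbabilityMeasure (flipLaw p z.1 z.2))⟩
  refine Measure.measurable_of_measurable_coe _ fun A hA => ?_
  have hm : ∀ z : EuclideanSpace ℝ (Fin d) × EuclideanSpace ℝ (Fin d),
      Measurable (update Δt σ z.1 z.2) := fun z =>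
    (measurable_update Δt hσ).comp (measurable_const.prodMk measurable_id :
      Measurable fun b : Fin d → ℝ => (z, b))
  have := Kernel.measurable_kernel_prodMk_left (κ := κ) (measurable_update Δt hσ hA)
  have e : (fun z : EuclideanSpace ℝ (Fin d) × EuclideanSpace ℝ (Fin d) =>
      (flipLaw p z.1 z.2).map (update Δt σ z.1 z.2) A) = fun z => κ z (Prod.mk z ⁻¹'
        ((fun z : (EuclideanSpace ℝ (Fin d) × EuclideanSpace ℝ (Fin d)) × (Fin d → ℝ) =>
          update Δt σ z.1.1 z.1.2 z.2) ⁻¹' A)) := by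
    funext z
    rw [Measure.map_apply (hm z) hA]
    rfl
  rw [e]
  exact this

theorem measurable_stepLaw {d : ℕ} (Δt : ℝ)
    {σ : EuclideanSpace ℝ (Fin d) → Matrix (Fin d) (Fin d) ℝ}
    {p : Fin d → EuclideanSpace ℝ (Fin d) → EuclideanSpace ℝ (Fin d) → unitInterval}
    (hσ : ∀ i j, Measurable fun x => σ x i j)
    (hp : ∀ i, Measurable fun z : EuclideanSpace ℝ (Fin d) × EuclideanSpace ℝ (Fin d) =>
      p i z.1 z.2) :
    Measurable (stepLaw Δt σ p) := by
  have h := measurable_map_flipLaw Δt hσ hp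
  refine Measure.measurable_of_measurable_coe _ fun A hA => ?_
  have e : ∀ x, stepLaw Δt σ p x A = ∫⁻ ν, (flipLaw p x ν).map (update Δt σ x ν) A
      ∂(stdGaussian (EuclideanSpace ℝ (Fin d))) := fun x =>
    Measure.bind_apply hA (h.comp (measurable_const.prodMk measurable_id :
      Measurable fun ν : EuclideanSpace ℝ (Fin d) => (x, ν))).aemeasurable
  simp only [e]
  exact ((Measure.measurable_coe hA).comp h).lintegral_prod_right'

/-- The Markov kernel `P` of the skew-symmetric scheme. -/
noncomputable def kernel {d : ℕ} (Δt : ℝ)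
    (σ : EuclideanSpace ℝ (Fin d) → Matrix (Fin d) (Fin d) ℝ)
    (p : Fin d → EuclideanSpace ℝ (Fin d) → EuclideanSpace ℝ (Fin d) → unitInterval)
    (hσ : ∀ i j, Measurable fun x => σ x i j)
    (hp : ∀ i, Measurable fun z : EuclideanSpace ℝ (Fin d) × EuclideanSpace ℝ (Fin d) =>
      p i z.1 z.2) :
    Kernel (EuclideanSpace ℝ (Fin d)) (EuclideanSpace ℝ (Fin d)) where
  toFun := stepLaw Δt σ p
  measurable' := measurable_stepLaw Δt hσ hp

instance instIsMarkovKernelKernel {d : ℕ} (Δt : ℝ)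
    (σ : EuclideanSpace ℝ (Fin d) → Matrix (Fin d) (Fin d) ℝ)
    (p : Fin d → EuclideanSpace ℝ (Fin d) → EuclideanSpace ℝ (Fin d) → unitInterval)
    (hσ : ∀ i j, Measurable fun x => σ x i j)
    (hp : ∀ i, Measurable fun z : EuclideanSpace ℝ (Fin d) × EuclideanSpace ℝ (Fin d) =>
      p i z.1 z.2) :
    IsMarkovKernel (kernel Δt σ p hσ hp) := by
  refine ⟨fun x => ⟨?_⟩⟩
  change stepLaw Δt σ p x Set.univ = 1
  have hx : Measurable fun ν : EuclideanSpace ℝ (Fin d) =>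
      (flipLaw p x ν).map (update Δt σ x ν) :=
    (measurable_map_flipLaw Δt hσ hp).comp (measurable_const.prodMk measurable_id :
      Measurable fun ν : EuclideanSpace ℝ (Fin d) => (x, ν))
  have hm : ∀ ν, Measurable (update Δt σ x ν) := fun ν =>
    (measurable_update Δt hσ).comp (measurable_const.prodMk measurable_id :
      Measurable fun b : Fin d → ℝ => ((x, ν), b))
  rw [stepLaw, Measure.bind_apply MeasurableSet.univ hx.aemeasurable]
  simp [Measure.map_apply (hm _) MeasurableSet.univ]

/-- Powers of a Markov kernel (`P ^ n` is the `n`-fold composition) are Markov kernels. -/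
instance instIsMarkovKernelPow {α : Type*} [MeasurableSpace α] (κ : Kernel α α) [IsMarkovKernel κ] (n : ℕ) :
    IsMarkovKernel (κ ^ n) := by
  induction n with
  | zero => rw [pow_zero]; exact inferInstanceAs (IsMarkovKernel (Kernel.id : Kernel α α))
  | succ n ih => rw [pow_succ]; exact inferInstanceAs (IsMarkovKernel ((κ ^ n) ∘ₖ κ))

/-- The total variation norm `‖μ - ν‖_TV` of the difference of two finite measures. -/
noncomputable def tvNorm {α : Type*} [MeasurableSpace α] (μ ν : Measure α)
    [IsFiniteMeasure μ] [IsFiniteMeasure ν] : ℝ :=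
  ((μ.toSignedMeasure - ν.toSignedMeasure).totalVariation Set.univ).toReal

end SkewSymmetric

/-! The chain satisfies the two hypotheses of Harris' theorem for the Lyapunov function `weight`,
V(x) = 1 + ∑ (e^{x_i} + e^{-x_i}).

Drift (`exists_drift`): far out, a coordinate with |x_i| > ‖x‖_∞/2 feels a huge inward μ_i, so its
increment points inwards with probability close to 1 unless |ν_i| is tiny. Since E e^{-s|ν_i|} < 1
for s > 0, the share of this coordinate in V shrinks by a factor q < 1, up to a constant. Nothing is
known about the signs of the other coordinates, but their shares are at most 2e^{‖x‖_∞/2} and grow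
by a bounded factor in one step. This is of order √V, hence absorbed by Young's inequality.

Minorization (`exists_minorization`): from a bounded set, and for bounded ν, all signs are kept with
probability bounded below, and the Gaussian increment has a density bounded below on [-1, 1]^d. So
one step dominates a fixed multiple of Lebesgue measure on this cube.

Harris (`exists_invariant_tvNorm_le_of_drift_of_minorization`): P contracts oscillations measured
against 2 + β(V x + V y). Applied to x ↦ P^n(x, A), this makes P^n(x, A) geometrically Cauchy,
uniformly in A. The setwise limit is a probability measure π, found without any continuity of P.
Fatou's lemma gives its invariance and the integrability of V, and V dominates every power of the
norm. -/

namespace SkewSymmetric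

open Filter Topology Set

/-! ### Total variation and setwise limits of measures -/

section SetwiseLimits

variable {α : Type*} [MeasurableSpace α]

/-- The total variation norm is controlled by the largest discrepancy over measurable sets. -/
theorem tvNorm_le_of_forall_abs_sub_le {μ ν : Measure α} [IsFiniteMeasure μ] [IsFiniteMeasure ν]
    {r : ℝ} (h : ∀ A, MeasurableSet A → |μ.real A - ν.real A| ≤ r) : tvNorm μ ν ≤ 2 * r := by
  set s : SignedMeasure α := μ.toSignedMeasure - ν.toSignedMeasure with hs
  have happly : ∀ A, MeasurableSet A → s A = μ.real A - ν.real A := by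
    intro A hA
    simp [hs, hA]
  set p := s.toJordanDecomposition.posPart
  set q := s.toJordanDecomposition.negPart
  -- Hahn decomposition: the positive part lives on Sᶜ and the negative part on S, so the total
  -- variation is a sum of two discrepancies, whence the factor 2.
  obtain ⟨S, hS, hpS, hqS⟩ := s.toJordanDecomposition.mutuallySingular
  have hp : p.real univ = p.real Sᶜ := by
    have := measureReal_add_measureReal_compl (μ := p) hS
    have h0 : p.real S = 0 := by rw [measureReal_def, hpS]; rfl
    linarith
  have hq : q.real univ = q.real S := by
    have := measureReal_add_measureReal_compl (μ := q) hS
    have h0 : q.real Sᶜ = 0 := by rw [measureReal_def, hqS]; rfl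
    linarith
  have e1 := s.apply_eq_posPart_real_sub_negPart_real hS.compl
  have e2 := s.apply_eq_posPart_real_sub_negPart_real hS
  have h0 : q.real Sᶜ = 0 := by rw [measureReal_def, hqS]; rfl
  have h0' : p.real S = 0 := by rw [measureReal_def, hpS]; rfl
  rw [happly _ hS.compl] at e1
  rw [happly _ hS] at e2
  have i1 := abs_le.1 (h _ hS.compl)
  have i2 := abs_le.1 (h _ hS)
  have e3 : tvNorm μ ν = p.real univ + q.real univ := by
    change s.totalVariation.real univ = _
    rw [SignedMeasure.totalVariation, measureReal_add_apply]
  change _ = p.real _ - q.real _ at e1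
  change _ = p.real _ - q.real _ at e2
  linarith [i1.1, i1.2, i2.1, i2.2]

/-- Fatou's lemma for a setwise convergent sequence of measures. -/
theorem lintegral_le_of_tendsto_measure {μ : ℕ → Measure α} {π : Measure α}
    (h : ∀ A, MeasurableSet A → Tendsto (fun n => μ n A) atTop (𝓝 (π A)))
    {f : α → ENNReal} {u : ℕ → ENNReal} {c : ENNReal} (hu : ∀ n, ∫⁻ x, f x ∂μ n ≤ u n)
    (huc : Tendsto u atTop (𝓝 c)) : ∫⁻ x, f x ∂π ≤ c := by
  rw [lintegral_eq_nnreal]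
  refine iSup₂_le fun φ hφ => ?_
  have ht : Tendsto (fun n => (φ.map ((↑) : NNReal → ENNReal)).lintegral (μ n)) atTop
      (𝓝 ((φ.map ((↑) : NNReal → ENNReal)).lintegral π)) := by
    simp only [SimpleFunc.map_lintegral]
    refine tendsto_finsetSum _ fun y _ => ?_
    exact ENNReal.Tendsto.const_mul (h _ (φ.measurableSet_preimage _)) (Or.inr ENNReal.coe_ne_top)
  refine le_of_tendsto_of_tendsto' ht huc fun n => le_trans ?_ (hu n)
  rw [← SimpleFunc.lintegral_eq_lintegral]
  exact lintegral_mono hφ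

/-- A uniform setwise limit of probability measures is a probability measure. -/
theorem exists_isProbabilityMeasure_of_uniform_setwise_limit (ν : ℕ → Measure α)
    [∀ n, IsProbabilityMeasure (ν n)] (m : Set α → ℝ) {r : ℕ → ℝ} (hr : Tendsto r atTop (𝓝 0))
    (h : ∀ n A, MeasurableSet A → |(ν n).real A - m A| ≤ r n) :
    ∃ π : Measure α, IsProbabilityMeasure π ∧ ∀ A, MeasurableSet A → π.real A = m A := by
  have hlim : ∀ A, MeasurableSet A → Tendsto (fun n => (ν n).real A) atTop (𝓝 (m A)) := by
    intro A hA
    rw [tendsto_iff_dist_tendsto_zero]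
    exact squeeze_zero (fun _ => dist_nonneg) (fun n => h n A hA) hr
  have hnn : ∀ A, MeasurableSet A → 0 ≤ m A := fun A hA =>
    ge_of_tendsto' (hlim A hA) fun n => measureReal_nonneg
  have hm0 : m ∅ = 0 := tendsto_nhds_unique (hlim ∅ .empty) (by simp)
  have hm1 : m univ = 1 := tendsto_nhds_unique (hlim univ .univ) (by simp)
  have hsum : ∀ f : ℕ → Set α, (∀ i, MeasurableSet (f i)) → Pairwise (Function.onFun Disjoint f) →
      HasSum (fun i => m (f i)) (m (⋃ i, f i)) := by
    intro f hf hd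
    rw [hasSum_iff_tendsto_nat_of_nonneg fun i => hnn _ (hf i)]
    have hfin : ∀ k, ∑ i ∈ Finset.range k, m (f i) = m (⋃ i ∈ Finset.range k, f i) := by
      intro k
      refine tendsto_nhds_unique (tendsto_finsetSum _ fun i _ => hlim _ (hf i)) ?_
      refine (hlim _ (Finset.measurableSet_biUnion _ fun i _ => hf i)).congr fun n => ?_
      exact measureReal_biUnion_finset (fun i _ j _ hij => hd hij) fun i _ => hf i
    simp only [hfin]
    -- The rate `r n` does not depend on the set, so the limits in n and in k may be exchanged: this
    -- is where countable additivity of `m` comes from.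
    have hunif : TendstoUniformly (fun n k => (ν n).real (⋃ i ∈ Finset.range k, f i))
        (fun k => m (⋃ i ∈ Finset.range k, f i)) atTop := by
      rw [Metric.tendstoUniformly_iff]
      intro ε hε
      filter_upwards [hr.eventually (gt_mem_nhds hε)] with n hn k
      rw [dist_comm]
      exact (h n _ (Finset.measurableSet_biUnion _ fun i _ => hf i)).trans_lt hn
    refine hunif.tendsto_of_eventually_tendsto (Eventually.of_forall fun n => ?_)
      (hlim _ (MeasurableSet.iUnion hf))
    have hmono : Monotone fun k => ⋃ i ∈ Finset.range k, f i := fun a b hab =>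
      biUnion_subset_biUnion_left fun i hi => Finset.range_mono hab hi
    have hU : ⋃ k, ⋃ i ∈ Finset.range k, f i = ⋃ i, f i := by
      ext x
      simp only [mem_iUnion, Finset.mem_range, exists_prop]
      exact ⟨fun ⟨_, i, _, hi⟩ => ⟨i, hi⟩, fun ⟨i, hi⟩ => ⟨i + 1, i, i.lt_succ_self, hi⟩⟩
    have ht := tendsto_measure_iUnion_atTop (μ := ν n) hmono
    rw [hU] at ht
    exact (ENNReal.tendsto_toReal (measure_ne_top _ _)).comp ht
  refine ⟨Measure.ofMeasurable (fun A _ => ENNReal.ofReal (m A)) (by simp [hm0]) ?_, ⟨?_⟩, ?_⟩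
  · intro f hf hd
    rw [← (hsum f hf hd).tsum_eq]
    exact ENNReal.ofReal_tsum_of_nonneg (fun i => hnn _ (hf i)) (hsum f hf hd).summable
  · rw [Measure.ofMeasurable_apply _ .univ]; simp [hm1]
  · intro A hA
    rw [measureReal_def, Measure.ofMeasurable_apply _ hA, ENNReal.toReal_ofReal (hnn A hA)]

end SetwiseLimits

/-! ### Harris' theorem by contraction of a weighted oscillation -/

section Harris

variable {α : Type*}

/-- A function whose oscillation is dominated by a separable weight lies, after subtraction of a
constant, below half of the weight. -/
theorem exists_abs_sub_le_of_abs_sub_le_add {φ w : α → ℝ}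
    (h : ∀ x y, |φ x - φ y| ≤ w x + w y) : ∃ t : ℝ, ∀ x, |φ x - t| ≤ w x := by
  rcases isEmpty_or_nonempty α with hα | hα
  · exact ⟨0, fun x => hα.elim x⟩
  have hle : ∀ x y, φ x - w x ≤ φ y + w y := fun x y => by linarith [(abs_le.1 (h x y)).2]
  have hbdd : BddAbove (range fun x => φ x - w x) :=
    ⟨φ hα.some + w hα.some, by rintro _ ⟨x, rfl⟩; exact hle x _⟩
  -- Every `φ x - w x` lies below every `φ y + w y`; the supremum of the former separates the two
  -- families.
  refine ⟨⨆ x, (φ x - w x), fun x => abs_le.2 ⟨?_, ?_⟩⟩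
  · have : ⨆ x, (φ x - w x) ≤ φ x + w x := ciSup_le fun y => hle y x
    linarith
  · have := le_ciSup hbdd x
    linarith

variable [MeasurableSpace α]

/-- Two measures with a common minorant: integrals of a function with a dominated oscillation
differ by at most the weighted masses of what remains after removing the minorant. -/
theorem abs_integral_sub_integral_le {μ ν η : Measure α} [IsProbabilityMeasure μ]
    [IsProbabilityMeasure ν] [IsFiniteMeasure η] (hμ : η ≤ μ) (hν : η ≤ ν) {V φ : α → ℝ}
    (hV0 : ∀ x, 0 ≤ V x) (hVμ : Integrable V μ) (hVν : Integrable V ν)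
    (hφμ : Integrable φ μ) (hφν : Integrable φ ν) {c β : ℝ} (hc : 0 ≤ c) (hβ : 0 ≤ β)
    (h : ∀ x y, |φ x - φ y| ≤ c * (2 + β * (V x + V y))) :
    |∫ x, φ x ∂μ - ∫ x, φ x ∂ν|
      ≤ c * (2 - 2 * η.real univ + β * (∫ x, V x ∂μ + ∫ x, V x ∂ν)) := by
  obtain ⟨t, ht⟩ := exists_abs_sub_le_of_abs_sub_le_add (φ := φ)
    (w := fun x => c * (1 + β * V x)) (fun x y => (h x y).trans_eq (by ring))
  -- The integral over `η` is the same for `μ` and `ν` and cancels in the difference. What remains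
  -- is `ρ - η`, of mass `1 - η.real univ`, on which `φ - t` is bounded by the weight.
  have key : ∀ (ρ : Measure α) [IsProbabilityMeasure ρ], η ≤ ρ → Integrable V ρ → Integrable φ ρ →
      |∫ x, φ x ∂ρ - t - ∫ x, (φ x - t) ∂η| ≤ c * (1 - η.real univ + β * ∫ x, V x ∂ρ) := by
    intro ρ _ hρ hVρ hφρ
    have hadd : ρ - η + η = ρ := Measure.sub_add_cancel_of_le hρ
    have hle : ρ - η ≤ ρ := Measure.sub_le
    have hfin : IsFiniteMeasure (ρ - η) := isFiniteMeasure_of_le ρ hle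
    have hint : Integrable (fun x => φ x - t) ρ := hφρ.sub (integrable_const t)
    have e1 : ∫ x, φ x ∂ρ - t = ∫ x, (φ x - t) ∂(ρ - η) + ∫ x, (φ x - t) ∂η := by
      rw [← integral_add_measure (hint.mono_measure hle) (hint.mono_measure hρ), hadd,
        integral_sub hφρ (integrable_const t)]
      simp
    have hmass : (ρ - η).real univ = 1 - η.real univ := by
      have : (ρ - η + η).real univ = ρ.real univ := by rw [hadd]
      rw [measureReal_add_apply, probReal_univ (μ := ρ)] at this
      linarith
    have hW : Integrable (fun x => c * (1 + β * V x)) ρ :=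
      ((integrable_const 1).add (hVρ.const_mul β)).const_mul c
    have hVle : ∫ x, V x ∂(ρ - η) ≤ ∫ x, V x ∂ρ :=
      integral_mono_measure hle (Eventually.of_forall hV0) hVρ
    rw [e1, add_sub_cancel_right]
    calc |∫ x, (φ x - t) ∂(ρ - η)| ≤ ∫ x, |φ x - t| ∂(ρ - η) := abs_integral_le_integral_abs
      _ ≤ ∫ x, c * (1 + β * V x) ∂(ρ - η) :=
        integral_mono (hint.mono_measure hle).abs (hW.mono_measure hle) ht
      _ = c * (1 - η.real univ + β * ∫ x, V x ∂(ρ - η)) := by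
        rw [integral_const_mul, integral_add (integrable_const _)
          ((hVρ.mono_measure hle).const_mul β), integral_const_mul]
        simp [hmass]
      _ ≤ _ := by gcongr
  have k1 := abs_le.1 (key μ hμ hVμ hφμ)
  have k2 := abs_le.1 (key ν hν hVν hφν)
  rw [abs_le]
  constructor <;> nlinarith [k1.1, k1.2, k2.1, k2.2]

/-- One step of a Markov kernel with a drift condition and a minorization condition contracts the
weighted oscillation seminorm. -/
theorem abs_integral_sub_integral_le_of_drift {P : Kernel α α} [IsMarkovKernel P] {V φ : α → ℝ}
    (hV0 : ∀ x, 0 ≤ V x) {γ K R β r c : ℝ} {η : Measure α} [IsFiniteMeasure η]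
    (hVint : ∀ x, Integrable V (P x)) (hdrift : ∀ x, ∫ y, V y ∂P x ≤ γ * V x + K)
    (hη : ∀ x, V x ≤ R → η ≤ P x) (hβ : 0 ≤ β) (hβK : β * K ≤ η.real univ / 2) (hγr : γ ≤ r)
    (hηr : 1 - η.real univ / 2 ≤ r) (hR : 2 + 2 * β * K + β * γ * R ≤ r * (2 + β * R))
    (hc : 0 ≤ c) (hφint : ∀ x, Integrable φ (P x))
    (h : ∀ x y, |φ x - φ y| ≤ c * (2 + β * (V x + V y))) (x y : α) :
    |∫ z, φ z ∂P x - ∫ z, φ z ∂P y| ≤ c * r * (2 + β * (V x + V y)) := by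
  rw [mul_assoc]
  have hx := mul_le_mul_of_nonneg_left (hdrift x) hβ
  have hy := mul_le_mul_of_nonneg_left (hdrift y) hβ
  -- If `V x + V y` is large, the drift alone contracts and the minorant is taken to be 0. Otherwise
  -- both points lie in the sublevel set, and the removed mass `2 * η.real univ` outweighs the loss
  -- `2 * β * K`.
  rcases le_total R (V x + V y) with hS | hS
  · refine (abs_integral_sub_integral_le (η := 0) (Measure.zero_le _) (Measure.zero_le _) hV0
      (hVint x) (hVint y) (hφint x) (hφint y) hc hβ h).trans
      (mul_le_mul_of_nonneg_left ?_ hc)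
    have h1 : 0 ≤ β * (r - γ) * (V x + V y - R) :=
      mul_nonneg (mul_nonneg hβ (sub_nonneg.2 hγr)) (sub_nonneg.2 hS)
    simp only [measureReal_zero_apply]
    nlinarith
  · refine (abs_integral_sub_integral_le (hη x (by linarith [hV0 y])) (hη y (by linarith [hV0 x]))
      hV0 (hVint x) (hVint y) (hφint x) (hφint y) hc hβ h).trans
      (mul_le_mul_of_nonneg_left ?_ hc)
    have h1 : 0 ≤ β * (r - γ) * (V x + V y) :=
      mul_nonneg (mul_nonneg hβ (sub_nonneg.2 hγr)) (add_nonneg (hV0 x) (hV0 y))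
    nlinarith

theorem pow_succ_real_apply (P : Kernel α α) [IsMarkovKernel P] (n : ℕ) (x : α) {A : Set α}
    (hA : MeasurableSet A) : ((P ^ (n + 1)) x).real A = ∫ y, ((P ^ n) y).real A ∂P x := by
  have h := Kernel.pow_add_apply_eq_lintegral P 1 n x hA
  rw [pow_one, add_comm] at h
  rw [measureReal_def, h, ← integral_toReal (Kernel.measurable_coe _ hA).aemeasurable
    (Eventually.of_forall fun y => measure_lt_top _ _)]
  rfl

theorem integrable_real_apply (P Q : Kernel α α) [IsMarkovKernel P] [IsMarkovKernel Q] (x : α)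
    {A : Set α} (hA : MeasurableSet A) : Integrable (fun y => (Q y).real A) (P x) := by
  refine Integrable.of_bound (C := 1)
    (Kernel.measurable_coe Q hA).ennreal_toReal.aestronglyMeasurable
    (Eventually.of_forall fun y => ?_)
  rw [Real.norm_of_nonneg measureReal_nonneg]
  exact measureReal_le_one

theorem integrable_of_lintegral_ofReal_le {μ : Measure α} {V : α → ℝ} (hV : Measurable V)
    (hV0 : ∀ x, 0 ≤ V x) {b : ℝ} (h : ∫⁻ x, ENNReal.ofReal (V x) ∂μ ≤ ENNReal.ofReal b) :
    Integrable V μ := by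
  refine ⟨hV.aestronglyMeasurable, ?_⟩
  rw [hasFiniteIntegral_iff_ofReal (Eventually.of_forall hV0)]
  exact h.trans_lt ENNReal.ofReal_lt_top

theorem integral_le_of_lintegral_ofReal_le {μ : Measure α} {V : α → ℝ} (hV : Measurable V)
    (hV0 : ∀ x, 0 ≤ V x) {b : ℝ} (hb : 0 ≤ b)
    (h : ∫⁻ x, ENNReal.ofReal (V x) ∂μ ≤ ENNReal.ofReal b) : ∫ x, V x ∂μ ≤ b := by
  rw [integral_eq_lintegral_of_nonneg_ae (Eventually.of_forall hV0) hV.aestronglyMeasurable]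
  exact ENNReal.toReal_le_of_le_ofReal hb h

/-- Under a drift condition the weight stays bounded in mean along the chain. -/
theorem lintegral_pow_le_of_drift {P : Kernel α α} [IsMarkovKernel P] {V : α → ℝ} (hV : Measurable V)
    (hV0 : ∀ x, 0 ≤ V x) {γ K : ℝ} (hγ0 : 0 ≤ γ) (hγ1 : γ < 1) (hK : 0 ≤ K)
    (hdrift : ∀ x, ∫⁻ y, ENNReal.ofReal (V y) ∂P x ≤ ENNReal.ofReal (γ * V x + K)) (n : ℕ)
    (x : α) : ∫⁻ y, ENNReal.ofReal (V y) ∂((P ^ n) x) ≤ ENNReal.ofReal (V x + K / (1 - γ)) := by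
  induction n generalizing x with
  | zero =>
    rw [pow_zero]
    change ∫⁻ y, ENNReal.ofReal (V y) ∂(Kernel.id x) ≤ _
    rw [Kernel.id_apply, lintegral_dirac' _ hV.ennreal_ofReal]
    have : 0 ≤ K / (1 - γ) := div_nonneg hK (by linarith)
    exact ENNReal.ofReal_le_ofReal (by linarith)
  | succ n ih =>
    have h1 : 0 < 1 - γ := by linarith
    have hb : 0 ≤ V x + K / (1 - γ) := add_nonneg (hV0 x) (div_nonneg hK h1.le)
    have e : P ^ (n + 1) = P ∘ₖ (P ^ n) := by rw [add_comm, Kernel.pow_add, pow_one]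
    rw [e, Kernel.lintegral_comp _ _ _ hV.ennreal_ofReal]
    calc ∫⁻ y, ∫⁻ z, ENNReal.ofReal (V z) ∂P y ∂(P ^ n) x
        ≤ ∫⁻ y, (ENNReal.ofReal γ * ENNReal.ofReal (V y) + ENNReal.ofReal K) ∂(P ^ n) x := by
          refine lintegral_mono fun y => (hdrift y).trans_eq ?_
          rw [ENNReal.ofReal_add (mul_nonneg hγ0 (hV0 y)) hK, ENNReal.ofReal_mul hγ0]
      _ = ENNReal.ofReal γ * ∫⁻ y, ENNReal.ofReal (V y) ∂(P ^ n) x + ENNReal.ofReal K := by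
          rw [lintegral_add_right _ measurable_const, lintegral_const_mul _ hV.ennreal_ofReal]
          simp
      _ ≤ ENNReal.ofReal γ * ENNReal.ofReal (V x + K / (1 - γ)) + ENNReal.ofReal K := by
          gcongr
          exact ih x
      _ = ENNReal.ofReal (γ * (V x + K / (1 - γ)) + K) := by
          rw [ENNReal.ofReal_add (mul_nonneg hγ0 hb) hK, ENNReal.ofReal_mul hγ0]
      _ ≤ ENNReal.ofReal (V x + K / (1 - γ)) := by
          refine ENNReal.ofReal_le_ofReal ?_
          have h2 : (1 - γ) * (K / (1 - γ)) = K := mul_div_cancel₀ _ h1.ne'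
          have h3 : 0 ≤ (1 - γ) * V x := mul_nonneg h1.le (hV0 x)
          linarith

/-- **Harris theorem**: a Markov kernel with a geometric drift condition, whose sublevel sets of
the weight all satisfy a minorization condition, is geometrically ergodic. -/
theorem exists_invariant_tvNorm_le_of_drift_of_minorization [Nonempty α] {P : Kernel α α}
    [IsMarkovKernel P] {V : α → ℝ} (hV : Measurable V) (hV0 : ∀ x, 0 ≤ V x) {γ K : ℝ}
    (hγ0 : 0 ≤ γ) (hγ1 : γ < 1) (hK : 0 ≤ K)
    (hdrift : ∀ x, ∫⁻ y, ENNReal.ofReal (V y) ∂P x ≤ ENNReal.ofReal (γ * V x + K))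
    (hminor : ∀ R : ℝ, ∃ η : Measure α, IsFiniteMeasure η ∧ η ≠ 0 ∧ ∀ x, V x ≤ R → η ≤ P x) :
    ∃ (π : Measure α) (_ : IsProbabilityMeasure π), P.Invariant π ∧ Integrable V π ∧
      ∃ C lam : ℝ, 0 < C ∧ 0 < lam ∧
        ∀ (n : ℕ) (x : α), tvNorm ((P ^ n) x) π ≤ C * (1 + V x) * Real.exp (-lam * n) := by
  have hb : ∀ x, 0 ≤ γ * V x + K := fun x => add_nonneg (mul_nonneg hγ0 (hV0 x)) hK
  have hVint : ∀ x, Integrable V (P x) := fun x => integrable_of_lintegral_ofReal_le hV hV0 (hdrift x)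
  have hVle : ∀ x, ∫ y, V y ∂P x ≤ γ * V x + K := fun x =>
    integral_le_of_lintegral_ofReal_le hV hV0 (hb x) (hdrift x)
  have hγ : 0 < 1 - γ := by linarith
  -- Chosen so that γR + 2K = R - 1 < R: beyond R the drift strictly wins.
  set R : ℝ := (2 * K + 1) / (1 - γ) with hRdef
  have hR0 : 0 < R := by positivity
  have hR1 : R * (1 - γ) = 2 * K + 1 := div_mul_cancel₀ _ hγ.ne'
  obtain ⟨η, hηfin, hηne, hη⟩ := hminor R
  set a : ℝ := η.real univ with ha
  have ha0 : 0 < a := by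
    rw [ha, measureReal_def]
    exact ENNReal.toReal_pos (by simpa using hηne) (measure_ne_top _ _)
  -- Makes βK at most a/2; K + 1 instead of K covers K = 0.
  set β : ℝ := a / (2 * (K + 1)) with hβdef
  have hβ0 : 0 < β := by positivity
  have hβ1 : β * (K + 1) = a / 2 := by rw [hβdef]; field_simp
  -- The entry 1/2 only keeps r positive, so that its logarithm can serve as the rate.
  set r : ℝ := max (max γ (1 - a / 2)) (max (1 / 2) ((2 + 2 * β * K + β * γ * R) / (2 + β * R)))
    with hrdef
  have hden : 0 < 2 + β * R := by positivity
  have hr1 : r < 1 := by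
    refine max_lt (max_lt hγ1 (by linarith)) (max_lt (by norm_num) ?_)
    rw [div_lt_one hden]
    nlinarith
  have hrhalf : 1 / 2 ≤ r := (le_max_left _ _).trans (le_max_right _ _)
  have hr0 : 0 < r := by linarith
  have hγr : γ ≤ r := (le_max_left _ _).trans (le_max_left _ _)
  have har : 1 - a / 2 ≤ r := (le_max_right _ _).trans (le_max_left _ _)
  have hRr : 2 + 2 * β * K + β * γ * R ≤ r * (2 + β * R) := by
    rw [← div_le_iff₀ hden]
    exact (le_max_right _ _).trans (le_max_right _ _)
  have hosc : ∀ (A : Set α), MeasurableSet A → ∀ (n : ℕ) (x y : α),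
      |((P ^ n) x).real A - ((P ^ n) y).real A| ≤ r ^ n * (2 + β * (V x + V y)) := by
    intro A hA n
    induction n with
    | zero =>
      intro x y
      have h1 : ((P ^ 0) x).real A ≤ 1 := measureReal_le_one
      have h2 : ((P ^ 0) y).real A ≤ 1 := measureReal_le_one
      have h3 : 0 ≤ ((P ^ 0) x).real A := measureReal_nonneg
      have h4 : 0 ≤ ((P ^ 0) y).real A := measureReal_nonneg
      have h5 : 0 ≤ β * (V x + V y) := mul_nonneg hβ0.le (add_nonneg (hV0 x) (hV0 y))
      rw [abs_le, pow_zero r]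
      constructor <;> linarith
    | succ n ih =>
      intro x y
      rw [pow_succ_real_apply P n x hA, pow_succ_real_apply P n y hA, pow_succ]
      exact abs_integral_sub_integral_le_of_drift hV0 hVint hVle hη hβ0.le (by linarith) hγr har
        hRr (by positivity) (fun z => integrable_real_apply P _ z hA) ih x y
  -- P^n(x, A) - P^{n+1}(x, A) is the average of P^n(x, A) - P^n(y, A) over y ∼ P(x, ·); `W x`
  -- bounds the average of the oscillation weight.
  set W : α → ℝ := fun x => 2 + β * (V x + (γ * V x + K)) with hW
  have hstep : ∀ (A : Set α), MeasurableSet A → ∀ (x : α) (n : ℕ),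
      dist (((P ^ n) x).real A) (((P ^ (n + 1)) x).real A) ≤ W x * r ^ n := by
    intro A hA x n
    have hi := integrable_real_apply P (P ^ n) x hA
    have e : ((P ^ n) x).real A - ((P ^ (n + 1)) x).real A
        = ∫ y, (((P ^ n) x).real A - ((P ^ n) y).real A) ∂P x := by
      rw [integral_sub (integrable_const _) hi, pow_succ_real_apply P n x hA]
      simp
    rw [Real.dist_eq, e]
    have hWi : Integrable (fun y => r ^ n * (2 + β * (V x + V y))) (P x) :=
      ((integrable_const 2).add (((integrable_const (V x)).add (hVint x)).const_mul β)).const_mul _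
    calc |∫ y, (((P ^ n) x).real A - ((P ^ n) y).real A) ∂P x|
        ≤ ∫ y, |((P ^ n) x).real A - ((P ^ n) y).real A| ∂P x := abs_integral_le_integral_abs
      _ ≤ ∫ y, r ^ n * (2 + β * (V x + V y)) ∂P x :=
        integral_mono ((integrable_const _).sub hi).abs hWi fun y => hosc A hA n x y
      _ = r ^ n * (2 + β * (V x + ∫ y, V y ∂P x)) := by
        have hi' : Integrable (fun y => V x + V y) (P x) := (integrable_const (V x)).add (hVint x)
        rw [integral_const_mul, integral_add (integrable_const _) (hi'.const_mul β),
          integral_const_mul, integral_add (integrable_const _) (hVint x)]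
        simp
      _ ≤ W x * r ^ n := by
        rw [mul_comm]
        gcongr
        exact add_le_add_right (mul_le_mul_of_nonneg_left (add_le_add_right (hVle x) _) hβ0.le) _
  obtain ⟨x₀⟩ := ‹Nonempty α›
  have hpow : Tendsto (fun n : ℕ => r ^ n) atTop (𝓝 0) :=
    tendsto_pow_atTop_nhds_zero_of_lt_one hr0.le hr1
  -- The limit does not depend on x, because the oscillation of P^n(·, A) tends to 0.
  have hex : ∀ A : Set α, ∃ m : ℝ, MeasurableSet A →
      ∀ x, Tendsto (fun n => ((P ^ n) x).real A) atTop (𝓝 m) := by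
    intro A
    by_cases hA : MeasurableSet A
    · obtain ⟨m, hm⟩ := cauchySeq_tendsto_of_complete
        (cauchySeq_of_le_geometric r (W x₀) hr1 (hstep A hA x₀))
      refine ⟨m, fun _ x => ?_⟩
      have hd : Tendsto (fun n => ((P ^ n) x).real A - ((P ^ n) x₀).real A) atTop (𝓝 0) := by
        refine squeeze_zero_norm (fun n => hosc A hA n x x₀) ?_
        simpa using hpow.mul_const (2 + β * (V x + V x₀))
      simpa using hd.add hm
    · exact ⟨0, fun h => absurd h hA⟩
  choose m hm using hex
  have hrate : ∀ (n : ℕ) (x : α) (A : Set α), MeasurableSet A →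
      |((P ^ n) x).real A - m A| ≤ W x * r ^ n / (1 - r) := fun n x A hA =>
    dist_le_of_le_geometric_of_tendsto r (W x) hr1 (hstep A hA x) (hm A hA x) n
  obtain ⟨π, hπ, hπm⟩ := exists_isProbabilityMeasure_of_uniform_setwise_limit
    (fun n => (P ^ n) x₀) m (r := fun n => W x₀ * r ^ n / (1 - r))
    (by simpa using (hpow.const_mul (W x₀)).div_const (1 - r)) (fun n A hA => hrate n x₀ A hA)
  have hset : ∀ A, MeasurableSet A → Tendsto (fun n => ((P ^ n) x₀) A) atTop (𝓝 (π A)) := by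
    intro A hA
    have h1 := hm A hA x₀
    rw [← hπm A hA] at h1
    exact (ENNReal.tendsto_toReal_iff (fun n => measure_ne_top _ _) (measure_ne_top _ _)).1 h1
  refine ⟨π, hπ, ?_, ?_, 2 * (2 + 2 * β + β * K) / (1 - r), -Real.log r, ?_, ?_, ?_⟩
  -- Fatou only gives π P ≤ π, but an inequality between two probability measures is an equality.
  · have hprob : IsProbabilityMeasure (π.bind P) := inferInstance
    refine Measure.eq_of_le_of_isProbabilityMeasure (Measure.le_iff.2 fun A hA => ?_)
    rw [Measure.bind_apply hA P.aemeasurable]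
    refine lintegral_le_of_tendsto_measure hset
      (fun n => (Kernel.pow_succ_apply_eq_lintegral P n x₀ hA).ge) ?_
    exact (hset A hA).comp (tendsto_add_atTop_nat 1)
  · exact integrable_of_lintegral_ofReal_le hV hV0 (lintegral_le_of_tendsto_measure hset
      (fun n => lintegral_pow_le_of_drift hV hV0 hγ0 hγ1 hK hdrift n x₀) tendsto_const_nhds)
  · have : 0 < 1 - r := by linarith
    positivity
  · exact neg_pos.2 (Real.log_neg hr0 hr1)
  · intro n x
    have h1 : tvNorm ((P ^ n) x) π ≤ 2 * (W x * r ^ n / (1 - r)) :=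
      tvNorm_le_of_forall_abs_sub_le fun A hA => by rw [hπm A hA]; exact hrate n x A hA
    have h2 : Real.exp (-(-Real.log r) * n) = r ^ n := by
      rw [neg_neg, mul_comm, Real.exp_nat_mul, Real.exp_log hr0]
    rw [h2]
    refine h1.trans ?_
    have h3 : W x ≤ (2 + 2 * β + β * K) * (1 + V x) := by
      have := hV0 x
      have h4 : 0 ≤ β * (1 - γ) * V x := by positivity
      have h5 : 0 ≤ β * K * V x := by positivity
      simp only [hW]
      nlinarith
    have h6 : 0 < 1 - r := by linarith
    calc 2 * (W x * r ^ n / (1 - r)) = 2 / (1 - r) * r ^ n * W x := by ring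
      _ ≤ 2 / (1 - r) * r ^ n * ((2 + 2 * β + β * K) * (1 + V x)) := by gcongr
      _ = _ := by ring

end Harris

/-! ### One-dimensional exponential estimates for a signed Gaussian step -/

section GaussianSteps

/-- An upper bound for `h exp (s t) + (1 - h) exp (-s t)` when the probability `h` of keeping the
sign of `t` is `η`-close to forcing a negative increment for `|t| ≥ η`. -/
noncomputable def stepBound (s₀ S η t : ℝ) : ℝ :=
  Real.exp (-(s₀ * |t|)) + η * Real.exp (S * |t|)
    + indicator {t : ℝ | |t| < η} (fun t => Real.exp (S * |t|)) t

theorem measurable_stepBound (s₀ S η : ℝ) : Measurable (stepBound s₀ S η) := by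
  unfold stepBound
  refine Measurable.add (by fun_prop) (Measurable.indicator (by fun_prop) ?_)
  exact measurableSet_lt (by fun_prop) measurable_const

theorem stepBound_nonneg {s₀ S η : ℝ} (hη : 0 ≤ η) (t : ℝ) : 0 ≤ stepBound s₀ S η t := by
  unfold stepBound
  have : 0 ≤ indicator {t : ℝ | |t| < η} (fun t => Real.exp (S * |t|)) t :=
    indicator_nonneg (fun _ _ => (Real.exp_pos _).le) _
  positivity

theorem mul_exp_add_mul_exp_neg_le_exp {h s S t : ℝ} (h0 : 0 ≤ h) (h1 : h ≤ 1) (hs : 0 ≤ s)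
    (hsS : s ≤ S) :
    h * Real.exp (s * t) + (1 - h) * Real.exp (-(s * t)) ≤ Real.exp (S * |t|) := by
  have e1 : Real.exp (s * t) ≤ Real.exp (S * |t|) := Real.exp_le_exp.2
    ((mul_le_mul_of_nonneg_left (le_abs_self t) hs).trans
      (mul_le_mul_of_nonneg_right hsS (abs_nonneg t)))
  have e2 : Real.exp (-(s * t)) ≤ Real.exp (S * |t|) := Real.exp_le_exp.2 <| by
    rw [← mul_neg]
    exact (mul_le_mul_of_nonneg_left (neg_le_abs t) hs).trans
      (mul_le_mul_of_nonneg_right hsS (abs_nonneg t))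
  nlinarith [mul_le_mul_of_nonneg_left e1 h0, mul_le_mul_of_nonneg_left e2 (sub_nonneg.2 h1)]

/-- For |t| ≥ η the growing exponential carries probability at most η and the other one is at most
e^{-s₀|t|}. For |t| < η nothing is known about h, and the indicator term pays the crude bound. -/
theorem mul_exp_add_mul_exp_neg_le_stepBound {h s₀ s S η t : ℝ} (h0 : 0 ≤ h) (h1 : h ≤ 1)
    (hs₀ : 0 ≤ s₀) (hs : s₀ ≤ s) (hsS : s ≤ S) (hη : 0 < η) (hpos : η ≤ t → h ≤ η)
    (hneg : t ≤ -η → 1 - h ≤ η) :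
    h * Real.exp (s * t) + (1 - h) * Real.exp (-(s * t)) ≤ stepBound s₀ S η t := by
  unfold stepBound
  have hE : 0 < Real.exp (S * |t|) := Real.exp_pos _
  have hE0 : 0 < Real.exp (-(s₀ * |t|)) := Real.exp_pos _
  by_cases ht : |t| < η
  · rw [indicator_of_mem (by exact ht)]
    have := mul_exp_add_mul_exp_neg_le_exp (t := t) h0 h1 (hs₀.trans hs) hsS
    nlinarith
  rw [indicator_of_notMem (by exact ht), add_zero]
  have hup : Real.exp (s * |t|) ≤ Real.exp (S * |t|) := by gcongr
  have hlow : Real.exp (-(s * |t|)) ≤ Real.exp (-(s₀ * |t|)) := by gcongr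
  have hP : 0 < Real.exp (s * |t|) := Real.exp_pos _
  have hN : 0 < Real.exp (-(s * |t|)) := Real.exp_pos _
  rcases le_total 0 t with h' | h'
  · rw [abs_of_nonneg h'] at *
    have := hpos (not_lt.1 ht)
    nlinarith [mul_le_mul this hup hP.le hη.le, mul_le_mul_of_nonneg_left hlow (sub_nonneg.2 h1)]
  · rw [abs_of_nonpos h'] at *
    have := hneg (by linarith [not_lt.1 ht])
    simp only [mul_neg, neg_neg] at *
    nlinarith [mul_le_mul this hup hP.le hη.le, mul_le_mul_of_nonneg_left hlow h0]

theorem integrable_exp_mul_abs_gaussianReal (c : ℝ) :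
    Integrable (fun t => Real.exp (c * |t|)) (gaussianReal 0 1) := by
  refine Integrable.mono' ((integrable_exp_mul_gaussianReal c).add
    (integrable_exp_mul_gaussianReal (-c))) (by fun_prop) (Eventually.of_forall fun t => ?_)
  rw [Real.norm_of_nonneg (Real.exp_pos _).le]
  have h1 := (Real.exp_pos (c * t)).le
  have h2 := (Real.exp_pos (-c * t)).le
  simp only [Pi.add_apply]
  rcases abs_choice t with h | h <;> rw [h]
  · linarith
  · rw [mul_neg, ← neg_mul]; linarith

/-- For a small enough tolerance the mean of `stepBound` is a contraction factor. -/
theorem exists_lintegral_stepBound_le {s₀ : ℝ} (hs₀ : 0 < s₀) (S : ℝ) :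
    ∃ η > 0, ∃ q : ℝ, 0 ≤ q ∧ q < 1 ∧
      ∫⁻ t, ENNReal.ofReal (stepBound s₀ S η t) ∂gaussianReal 0 1 ≤ ENNReal.ofReal q := by
  have hI0 : Integrable (fun t => Real.exp (-(s₀ * |t|))) (gaussianReal 0 1) := by
    simpa [neg_mul] using integrable_exp_mul_abs_gaussianReal (-s₀)
  have hIS := integrable_exp_mul_abs_gaussianReal S
  have hzero : gaussianReal 0 1 {(0 : ℝ)} = 0 := by
    have := nullSingletonClass_gaussianReal (μ := 0) (v := 1) one_ne_zero
    exact measure_singleton _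
  have hne : ∀ᵐ t ∂gaussianReal 0 1, t ≠ 0 := measure_eq_zero_iff_ae_notMem.1 hzero
  have hD : Integrable (fun t => 1 - Real.exp (-(s₀ * |t|))) (gaussianReal 0 1) :=
    (integrable_const 1).sub hI0
  -- Strict because t ≠ 0 almost surely.
  have hlt : ∫ t, Real.exp (-(s₀ * |t|)) ∂gaussianReal 0 1 < 1 := by
    have h : 0 < ∫ t, (1 - Real.exp (-(s₀ * |t|))) ∂gaussianReal 0 1 := by
      rw [integral_pos_iff_support_of_nonneg _ hD]
      · have : (Function.support fun t : ℝ => 1 - Real.exp (-(s₀ * |t|)))ᶜ ⊆ {0} := by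
          intro t ht
          simp only [Function.mem_support, mem_compl_iff, not_not] at ht
          have : Real.exp (-(s₀ * |t|)) = 1 := by linarith
          rw [Real.exp_eq_one_iff, neg_eq_zero, mul_eq_zero] at this
          exact abs_eq_zero.1 (this.resolve_left hs₀.ne')
        have h0 : gaussianReal 0 1 (Function.support fun t : ℝ => 1 - Real.exp (-(s₀ * |t|)))ᶜ = 0 :=
          measure_mono_null this hzero
        have h1 := prob_compl_eq_zero_iff (μ := gaussianReal 0 1)
          (s := Function.support fun t : ℝ => 1 - Real.exp (-(s₀ * |t|)))
          (measurableSet_support (by fun_prop))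
        rw [h1.1 h0]
        exact one_pos
      · intro t
        simp only [Pi.zero_apply, sub_nonneg, Real.exp_le_one_iff, neg_nonpos]
        positivity
    rw [integral_sub (integrable_const 1) hI0] at h
    simp at h
    linarith
  have hbound : ∀ n : ℕ, ∀ t, ‖stepBound s₀ S (1 / ((n : ℝ) + 1)) t‖
      ≤ Real.exp (-(s₀ * |t|)) + Real.exp (S * |t|) + Real.exp (S * |t|) := by
    intro n t
    have hn : (0 : ℝ) ≤ 1 / ((n : ℝ) + 1) := by positivity
    have hn1 : 1 / ((n : ℝ) + 1) ≤ 1 := by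
      rw [div_le_one (by positivity)]
      linarith [(Nat.cast_nonneg n : (0 : ℝ) ≤ n)]
    rw [Real.norm_of_nonneg (stepBound_nonneg hn t)]
    unfold stepBound
    gcongr
    · exact mul_le_of_le_one_left (Real.exp_pos _).le hn1
    · exact indicator_le_self' (fun _ _ => (Real.exp_pos _).le) t
  have hIB : Integrable (fun t => Real.exp (-(s₀ * |t|)) + Real.exp (S * |t|) + Real.exp (S * |t|))
      (gaussianReal 0 1) := (hI0.add hIS).add hIS
  -- Dominated convergence along η = 1/(n + 1): for t ≠ 0 both error terms of `stepBound` vanish in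
  -- the limit.
  have htend : Tendsto (fun n : ℕ => ∫ t, stepBound s₀ S (1 / ((n : ℝ) + 1)) t ∂gaussianReal 0 1)
      atTop (𝓝 (∫ t, Real.exp (-(s₀ * |t|)) ∂gaussianReal 0 1)) := by
    refine tendsto_integral_of_dominated_convergence _
      (fun n => (measurable_stepBound _ _ _).aestronglyMeasurable) hIB
      (fun n => Eventually.of_forall (hbound n)) ?_
    filter_upwards [hne] with t ht
    have hz : Tendsto (fun n : ℕ => 1 / ((n : ℝ) + 1)) atTop (𝓝 0) :=
      tendsto_one_div_add_atTop_nhds_zero_nat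
    have h1 : Tendsto (fun n : ℕ => Real.exp (-(s₀ * |t|)) + 1 / ((n : ℝ) + 1) * Real.exp (S * |t|))
        atTop (𝓝 (Real.exp (-(s₀ * |t|)))) := by
      simpa using (hz.mul_const (Real.exp (S * |t|))).const_add (Real.exp (-(s₀ * |t|)))
    refine h1.congr' ?_
    filter_upwards [hz.eventually (gt_mem_nhds (abs_pos.2 ht))] with n hn
    rw [stepBound, indicator_of_notMem (by simpa using hn.le), add_zero]
  obtain ⟨n, hn⟩ := (htend.eventually (gt_mem_nhds hlt)).exists
  have hn0 : (0 : ℝ) < 1 / ((n : ℝ) + 1) := by positivity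
  refine ⟨_, hn0, _, integral_nonneg fun t => stepBound_nonneg hn0.le t, hn, ?_⟩
  rw [ofReal_integral_eq_lintegral_ofReal (hIB.mono'
    (measurable_stepBound _ _ _).aestronglyMeasurable (Eventually.of_forall (hbound n)))
    (Eventually.of_forall fun t => stepBound_nonneg hn0.le t)]

end GaussianSteps

/-! ### Coordinate marginals of the kernel -/

section Marginal

variable {d : ℕ} {Δt : ℝ} {σ : EuclideanSpace ℝ (Fin d) → Matrix (Fin d) (Fin d) ℝ}
  {p : Fin d → EuclideanSpace ℝ (Fin d) → EuclideanSpace ℝ (Fin d) → unitInterval}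

theorem update_apply (hdiag : ∀ i j, i ≠ j → ∀ x, σ x i j = 0) (x ν : EuclideanSpace ℝ (Fin d))
    (b : Fin d → ℝ) (i : Fin d) : update Δt σ x ν b i = x i + √Δt * σ x i i * (b i * ν i) := by
  have : ((σ x).mulVec fun i => b i * ν i) i = σ x i i * (b i * ν i) := by
    rw [Matrix.mulVec, dotProduct, Finset.sum_eq_single i]
    · intro j _ hj
      rw [hdiag i j hj.symm, zero_mul]
    · simp
  simp [update, this, mul_assoc]

theorem map_eval_stdGaussian (i : Fin d) :
    (stdGaussian (EuclideanSpace ℝ (Fin d))).map (fun ν => ν i) = gaussianReal 0 1 := by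
  rw [← map_pi_eq_stdGaussian, Measure.map_map (by fun_prop) (by fun_prop)]
  exact (measurePreserving_eval (fun _ : Fin d => gaussianReal 0 1) i).map_eq

theorem toNNReal_eq_ofReal (q : unitInterval) :
    ((unitInterval.toNNReal q : NNReal) : ENNReal) = ENNReal.ofReal (q : ℝ) := by
  rw [ENNReal.ofReal, ENNReal.coe_inj]; ext; simp [q.2.1]

theorem lintegral_bernoulliMeasure (q : unitInterval) {f : ℝ → ENNReal} (hf : Measurable f) :
    ∫⁻ b, f b ∂bernoulliMeasure (1 : ℝ) (-1) q
      = ENNReal.ofReal q * f 1 + ENNReal.ofReal (1 - q) * f (-1) := by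
  rw [bernoulliMeasure_def, lintegral_add_measure, lintegral_smul_measure, lintegral_smul_measure,
    lintegral_dirac' _ hf, lintegral_dirac' _ hf, ENNReal.smul_def, ENNReal.smul_def,
    toNNReal_eq_ofReal, toNNReal_eq_ofReal, smul_eq_mul, smul_eq_mul, unitInterval.coe_symm_eq]

theorem measurable_update_right (hσ : ∀ i j, Measurable fun x => σ x i j)
    (x ν : EuclideanSpace ℝ (Fin d)) : Measurable (update Δt σ x ν) :=
  (measurable_update Δt hσ).comp (measurable_const.prodMk measurable_id :
    Measurable fun b : Fin d → ℝ => ((x, ν), b))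

theorem measurable_map_flipLaw_right (hσ : ∀ i j, Measurable fun x => σ x i j)
    (hp : ∀ i, Measurable fun z : EuclideanSpace ℝ (Fin d) × EuclideanSpace ℝ (Fin d) =>
      p i z.1 z.2) (x : EuclideanSpace ℝ (Fin d)) :
    Measurable fun ν => (flipLaw p x ν).map (update Δt σ x ν) :=
  (measurable_map_flipLaw Δt hσ hp).comp (measurable_const.prodMk measurable_id :
    Measurable fun ν : EuclideanSpace ℝ (Fin d) => (x, ν))

/-- Each coordinate of the chain moves by a one-dimensional skew-symmetric step. -/
theorem lintegral_kernel_apply (hσ : ∀ i j, Measurable fun x => σ x i j)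
    (hp : ∀ i, Measurable fun z : EuclideanSpace ℝ (Fin d) × EuclideanSpace ℝ (Fin d) =>
      p i z.1 z.2)
    (hdiag : ∀ i j, i ≠ j → ∀ x, σ x i j = 0) {g : Fin d → EuclideanSpace ℝ (Fin d) → ℝ → ℝ}
    (hg : ∀ i x ν, (p i x ν : ℝ) = g i x (ν i)) (x : EuclideanSpace ℝ (Fin d)) (i : Fin d)
    {f : ℝ → ENNReal} (hf : Measurable f) :
    ∫⁻ y, f (y i) ∂kernel Δt σ p hσ hp x
      = ∫⁻ t, (ENNReal.ofReal (g i x t) * f (x i + √Δt * σ x i i * t)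
        + ENNReal.ofReal (1 - g i x t) * f (x i - √Δt * σ x i i * t)) ∂gaussianReal 0 1 := by
  -- Measurability of `g` is inherited from `p`, evaluated at vectors with all entries equal.
  have hgm : Measurable (g i x) := by
    have h1 : g i x = fun t => (p i x (WithLp.toLp 2 fun _ => t) : ℝ) := by
      funext t; rw [hg]
    rw [h1]
    have h2 : Measurable fun t : ℝ => (x, WithLp.toLp 2 fun _ : Fin d => t) := by fun_prop
    exact measurable_subtype_coe.comp ((hp i).comp h2)
  change ∫⁻ y, f (y i) ∂stepLaw Δt σ p x = _
  have hfi : Measurable fun y : EuclideanSpace ℝ (Fin d) => f (y i) := by fun_prop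
  rw [stepLaw, Measure.lintegral_bind (measurable_map_flipLaw_right hσ hp x).aemeasurable
    hfi.aemeasurable, ← map_eval_stdGaussian i, lintegral_map (by fun_prop) (by fun_prop)]
  refine lintegral_congr fun ν => ?_
  rw [lintegral_map hfi (measurable_update_right hσ x ν)]
  simp only [update_apply hdiag]
  have h := (measurePreserving_eval (fun i => bernoulliMeasure (1 : ℝ) (-1) (p i x ν)) i).lintegral_comp
    (f := fun b => f (x i + √Δt * σ x i i * (b * ν i))) (by fun_prop)
  rw [flipLaw]
  simp only [Function.eval] at h
  rw [h, lintegral_bernoulliMeasure _ (by fun_prop), hg]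
  simp [sub_eq_add_neg]

end Marginal

/-! ### Minorization on bounded sets -/

section Minorization

/-- `OuterMeasure.pi` is the largest outer measure bounded by the product on boxes, so comparing
boxes suffices. -/
theorem pi_mono_measure {ι : Type*} [Fintype ι] {X : ι → Type*} [∀ i, MeasurableSpace (X i)]
    {μ ν : ∀ i, Measure (X i)} [∀ i, SigmaFinite (μ i)] (h : ∀ i, μ i ≤ ν i) :
    Measure.pi μ ≤ Measure.pi ν := by
  refine Measure.le_iff.2 fun A hA => ?_
  rw [Measure.pi_def (μ := ν), toMeasure_apply _ _ hA]
  have hle : (Measure.pi μ).toOuterMeasure ≤ OuterMeasure.pi fun i => (ν i).toOuterMeasure := by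
    refine OuterMeasure.le_pi.2 fun s _ => ?_
    change Measure.pi μ (univ.pi s) ≤ _
    rw [Measure.pi_pi]
    exact Finset.prod_le_prod' fun i _ => h i (s i)
  exact hle A

/-- Gaussian densities with bounded mean and variance in a compact subset of `(0, ∞)` are
uniformly bounded below on `[-1, 1]`. -/
theorem smul_volume_restrict_le_map_gaussianReal {m s s₀ S R : ℝ} (hs₀ : 0 < s₀) (hs : s₀ ≤ s)
    (hsS : s ≤ S) (hm : |m| ≤ R) :
    ENNReal.ofReal ((√(2 * Real.pi * S ^ 2))⁻¹ * Real.exp (-(R + 1) ^ 2 / (2 * s₀ ^ 2)))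
        • (volume.restrict (Icc (-1 : ℝ) 1))
      ≤ ((gaussianReal 0 1).map fun t => m + s * t).restrict (Icc (-1) 1) := by
  have hs0 : 0 < s := hs₀.trans_le hs
  have e : (gaussianReal 0 1).map (fun t => m + s * t)
      = gaussianReal m (NNReal.mk (s ^ 2) (sq_nonneg s)) := by
    have h1 := gaussianReal_map_const_mul (μ := 0) (v := 1) s
    have h2 := gaussianReal_map_const_add (μ := s * 0) (v := NNReal.mk (s ^ 2) (sq_nonneg s) * 1) m
    rw [← h1, Measure.map_map (by fun_prop) (by fun_prop)] at h2
    simpa [Function.comp_def] using h2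
  have hv : (NNReal.mk (s ^ 2) (sq_nonneg s)) ≠ 0 := by
    intro h
    have h2 : s ^ 2 = 0 := congrArg NNReal.toReal h
    exact (pow_pos hs0 2).ne' h2
  rw [e, gaussianReal_of_var_ne_zero _ hv, restrict_withDensity measurableSet_Icc,
    ← withDensity_const]
  refine withDensity_mono ?_
  filter_upwards [ae_restrict_mem measurableSet_Icc] with y hy
  refine ENNReal.ofReal_le_ofReal ?_
  change _ ≤ (√(2 * Real.pi * s ^ 2))⁻¹ * Real.exp (-(y - m) ^ 2 / (2 * s ^ 2))
  have hsq : (y - m) ^ 2 ≤ (R + 1) ^ 2 := by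
    have h1 := abs_le.1 hm
    exact sq_le_sq' (by linarith [hy.1]) (by linarith [hy.2])
  gcongr ?_ * ?_
  · gcongr
  · refine Real.exp_le_exp.2 ?_
    rw [neg_div, neg_div, neg_le_neg_iff]
    gcongr

variable {d : ℕ} {Δt : ℝ} {σ : EuclideanSpace ℝ (Fin d) → Matrix (Fin d) (Fin d) ℝ}
  {p : Fin d → EuclideanSpace ℝ (Fin d) → EuclideanSpace ℝ (Fin d) → unitInterval}

theorem abs_apply_le_supNorm (x : EuclideanSpace ℝ (Fin d)) (i : Fin d) : |x i| ≤ supNorm x :=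
  norm_le_pi_norm (WithLp.ofLp x) i

theorem supNorm_nonneg (x : EuclideanSpace ℝ (Fin d)) : 0 ≤ supNorm x := norm_nonneg _

theorem norm_le_mul_supNorm (x : EuclideanSpace ℝ (Fin d)) : ‖x‖ ≤ d * supNorm x := by
  have h0 := supNorm_nonneg x
  rw [EuclideanSpace.norm_eq]
  refine Real.sqrt_le_iff.2 ⟨by positivity, ?_⟩
  calc ∑ i, ‖x i‖ ^ 2 ≤ ∑ _i : Fin d, supNorm x ^ 2 :=
        Finset.sum_le_sum fun i _ => by gcongr; exact abs_apply_le_supNorm x i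
    _ = d * supNorm x ^ 2 := by simp
    _ ≤ (d * supNorm x) ^ 2 := by
        rw [mul_pow]
        gcongr
        exact_mod_cast Nat.le_self_pow two_ne_zero d

theorem flipLaw_singleton_one (x ν : EuclideanSpace ℝ (Fin d)) :
    flipLaw p x ν (univ.pi fun _ => {1}) = ∏ i, ENNReal.ofReal (p i x ν) := by
  rw [flipLaw, Measure.pi_pi]
  refine Finset.prod_congr rfl fun i _ => ?_
  rw [bernoulliMeasure_apply_of_mem_of_notMem _ (measurableSet_singleton _) (mem_singleton _)
    (by norm_num), toNNReal_eq_ofReal]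

/-- Keeping all signs already produces a fixed multiple of the Gaussian increment law, as long as
the acceptance probabilities are bounded below. -/
theorem mul_stdGaussian_le_kernel (hσ : ∀ i j, Measurable fun x => σ x i j)
    (hp : ∀ i, Measurable fun z : EuclideanSpace ℝ (Fin d) × EuclideanSpace ℝ (Fin d) =>
      p i z.1 z.2) (x : EuclideanSpace ℝ (Fin d)) {B A : Set (EuclideanSpace ℝ (Fin d))}
    {ε : Fin d → ℝ} (hB : MeasurableSet B) (hε : ∀ i, ∀ ν ∈ B, ε i ≤ p i x ν)
    (hA : MeasurableSet A) :
    (∏ i, ENNReal.ofReal (ε i)) * stdGaussian (EuclideanSpace ℝ (Fin d))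
        (B ∩ (fun ν => update Δt σ x ν 1) ⁻¹' A) ≤ kernel Δt σ p hσ hp x A := by
  change _ ≤ stepLaw Δt σ p x A
  have hT : Measurable fun ν => update Δt σ x ν 1 :=
    (measurable_update Δt hσ).comp ((measurable_const.prodMk measurable_id).prodMk
      measurable_const : Measurable fun ν : EuclideanSpace ℝ (Fin d) => ((x, ν), (1 : Fin d → ℝ)))
  rw [stepLaw, Measure.bind_apply hA (measurable_map_flipLaw_right hσ hp x).aemeasurable,
    ← setLIntegral_const, ← lintegral_indicator (hB.inter (hT hA))]
  refine lintegral_mono (indicator_le' (fun ν hν => ?_) fun _ _ => zero_le)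
  rw [Measure.map_apply (measurable_update_right hσ x ν) hA]
  calc ∏ i, ENNReal.ofReal (ε i) ≤ ∏ i, ENNReal.ofReal (p i x ν) :=
        Finset.prod_le_prod' fun i _ => ENNReal.ofReal_le_ofReal (hε i ν hν.1)
    _ = flipLaw p x ν (univ.pi fun _ => {1}) := (flipLaw_singleton_one x ν).symm
    _ ≤ _ := by
        refine measure_mono fun b hb => ?_
        have : b = 1 := funext fun i => hb i (mem_univ i)
        rw [this]
        exact hν.2

/-- The chain started in a bounded set dominates a fixed nonzero measure after one step. -/
theorem exists_minorization (hσ : ∀ i j, Measurable fun x => σ x i j)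
    (hp : ∀ i, Measurable fun z : EuclideanSpace ℝ (Fin d) × EuclideanSpace ℝ (Fin d) =>
      p i z.1 z.2)
    (hdiag : ∀ i j, i ≠ j → ∀ x, σ x i j = 0) {s₀ S : ℝ} (hs₀ : 0 < s₀)
    (hs : ∀ i x, s₀ ≤ √Δt * σ x i i ∧ √Δt * σ x i i ≤ S)
    {g : Fin d → EuclideanSpace ℝ (Fin d) → ℝ → ℝ}
    (hg : ∀ i x ν, (p i x ν : ℝ) = g i x (ν i))
    (hg_compact : ∀ i, ∀ K : Set (EuclideanSpace ℝ (Fin d) × ℝ), IsCompact K →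
      ∃ ε > 0, ∀ z ∈ K, ε ≤ g i z.1 z.2) (R : ℝ) :
    ∃ η : Measure (EuclideanSpace ℝ (Fin d)), IsFiniteMeasure η ∧ η ≠ 0 ∧
      ∀ x, supNorm x ≤ R → η ≤ kernel Δt σ p hσ hp x := by
  -- For d = 0 the state space is a point and the kernel is its own minorant; a coordinate is needed
  -- below to get 0 < S.
  rcases d.eq_zero_or_pos with rfl | hd
  · refine ⟨kernel Δt σ p hσ hp 0, inferInstance, IsProbabilityMeasure.ne_zero _, fun x _ => ?_⟩
    rw [Subsingleton.elim x 0]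
  have hS : 0 < S := hs₀.trans_le ((hs ⟨0, hd⟩ 0).1.trans (hs ⟨0, hd⟩ 0).2)
  -- A step from |x_i| ≤ R into [-1, 1] has length at most R + 1, hence |ν_i| ≤ (R + 1)/s₀: only a
  -- compact set of arguments of `g` matters.
  set ρ : ℝ := (R + 1) / s₀ with hρ
  choose ε hε0 hε using fun i => hg_compact i
    (Metric.closedBall 0 (d * R) ×ˢ Icc (-ρ) ρ) ((isCompact_closedBall _ _).prod isCompact_Icc)
  set c : ℝ := (√(2 * Real.pi * S ^ 2))⁻¹ * Real.exp (-(R + 1) ^ 2 / (2 * s₀ ^ 2)) with hc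
  have hc0 : 0 < c := by positivity
  set E : ENNReal := ∏ i, ENNReal.ofReal (ε i) with hE
  have hE0 : E ≠ 0 := Finset.prod_ne_zero_iff.2 fun i _ => by simpa using hε0 i
  have hEtop : E ≠ ⊤ := ENNReal.prod_ne_top fun i _ => ENNReal.ofReal_ne_top
  set θ : Measure ℝ := ENNReal.ofReal c • (volume.restrict (Icc (-1 : ℝ) 1)) with hθ
  have hθfin : IsFiniteMeasure θ := Measure.smul_finite _ ENNReal.ofReal_ne_top
  have hθuniv : θ univ ≠ 0 := by
    simp [hθ, hc0]
  refine ⟨E • (Measure.pi fun _ : Fin d => θ).map (WithLp.toLp 2), ?_, ?_, ?_⟩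
  · exact Measure.smul_finite _ hEtop
  · rw [← Measure.measure_univ_ne_zero, Measure.smul_apply, Measure.map_apply (by fun_prop) .univ,
      preimage_univ, Measure.pi_univ]
    exact mul_ne_zero hE0 (Finset.prod_ne_zero_iff.2 fun _ _ => hθuniv)
  intro x hx
  have hxi : ∀ i, |x i| ≤ R := fun i => (abs_apply_le_supNorm x i).trans hx
  have hxball : x ∈ Metric.closedBall (0 : EuclideanSpace ℝ (Fin d)) (d * R) := by
    rw [mem_closedBall_zero_iff]
    exact (norm_le_mul_supNorm x).trans (by gcongr)
  set B : Set (EuclideanSpace ℝ (Fin d)) := {ν | ∀ i, ν i ∈ Icc (-ρ) ρ} with hBdef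
  have hB : MeasurableSet B := by
    rw [hBdef, ofPred_forall]
    refine MeasurableSet.iInter fun i => ?_
    have : Measurable fun ν : EuclideanSpace ℝ (Fin d) => ν i := by fun_prop
    exact this measurableSet_Icc
  refine Measure.le_iff.2 fun A hA => ?_
  refine le_trans ?_ (mul_stdGaussian_le_kernel hσ hp x hB
    (fun i ν hν => (hε i (x, ν i) ⟨hxball, hν i⟩).trans_eq (hg i x ν).symm) hA)
  rw [Measure.smul_apply, smul_eq_mul]
  gcongr E * ?_
  set ψ : Fin d → ℝ → ℝ := fun i t => x i + √Δt * σ x i i * t with hψ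
  have hψm : ∀ i, Measurable (ψ i) := fun i => by simp only [hψ]; fun_prop
  have hprob : ∀ i, IsProbabilityMeasure ((gaussianReal 0 1).map (ψ i)) := fun i =>
    Measure.isProbabilityMeasure_map (hψm i).aemeasurable
  have hA' : MeasurableSet ((WithLp.toLp 2 : (Fin d → ℝ) → EuclideanSpace ℝ (Fin d)) ⁻¹' A) :=
    (by fun_prop : Measurable (WithLp.toLp 2 : (Fin d → ℝ) → EuclideanSpace ℝ (Fin d))) hA
  have hbox : MeasurableSet (univ.pi fun _ : Fin d => Icc (-1 : ℝ) 1) :=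
    MeasurableSet.univ_pi fun _ => measurableSet_Icc
  rw [Measure.map_apply (by fun_prop) hA]
  calc (Measure.pi fun _ : Fin d => θ) (WithLp.toLp 2 ⁻¹' A)
      ≤ (Measure.pi fun i => ((gaussianReal 0 1).map (ψ i)).restrict (Icc (-1) 1))
          (WithLp.toLp 2 ⁻¹' A) :=
        pi_mono_measure (fun i => smul_volume_restrict_le_map_gaussianReal hs₀ (hs i x).1
          (hs i x).2 (hxi i)) _
    _ = Measure.pi (fun _ : Fin d => gaussianReal 0 1) ((fun v i => ψ i (v i)) ⁻¹'
          (WithLp.toLp 2 ⁻¹' A ∩ univ.pi fun _ => Icc (-1) 1)) := by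
        rw [← Measure.restrict_pi_pi, Measure.restrict_apply hA',
          ← Measure.pi_map_pi fun i => (hψm i).aemeasurable,
          Measure.map_apply (by fun_prop) (hA'.inter hbox)]
    _ ≤ Measure.pi (fun _ : Fin d => gaussianReal 0 1) (WithLp.toLp 2 ⁻¹'
          (B ∩ (fun ν => update Δt σ x ν 1) ⁻¹' A)) := by
        refine measure_mono fun v hv => ⟨fun i => ?_, ?_⟩
        · have h1 := hv.2 i (mem_univ i)
          have h2 := abs_le.1 (hxi i)
          have h3 := (hs i x).1
          have h4 : 0 < √Δt * σ x i i := hs₀.trans_le h3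
          have h5 : |√Δt * σ x i i * v i| ≤ R + 1 := by
            simp only [hψ, mem_Icc] at h1
            exact abs_le.2 ⟨by linarith [h1.1], by linarith [h1.2]⟩
          rw [abs_mul, abs_of_pos h4] at h5
          have h6 : |v i| ≤ ρ := by
            rw [hρ, le_div_iff₀ hs₀, mul_comm]
            exact (mul_le_mul_of_nonneg_right h3 (abs_nonneg _)).trans h5
          exact abs_le.1 h6
        · have h1 : update Δt σ x (WithLp.toLp 2 v) 1 = WithLp.toLp 2 fun i => ψ i (v i) := by
            ext i
            rw [update_apply hdiag]
            simp [hψ]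
          change update Δt σ x (WithLp.toLp 2 v) 1 ∈ A
          rw [h1]
          exact hv.1
    _ ≤ stdGaussian (EuclideanSpace ℝ (Fin d)) (B ∩ (fun ν => update Δt σ x ν 1) ⁻¹' A) := by
        rw [← map_pi_eq_stdGaussian]
        exact Measure.le_map_apply (by fun_prop) _

end Minorization

/-! ### Geometric drift of the exponential weight -/

section Drift

/-- The symmetric exponential weight on the line. -/
noncomputable def coordWeight (u : ℝ) : ℝ := Real.exp u + Real.exp (-u)

theorem coordWeight_pos (u : ℝ) : 0 < coordWeight u := by unfold coordWeight; positivity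

theorem coordWeight_neg (u : ℝ) : coordWeight (-u) = coordWeight u := by
  rw [coordWeight, coordWeight, neg_neg, add_comm]

theorem measurable_coordWeight : Measurable coordWeight := by unfold coordWeight; fun_prop

theorem exp_abs_le_coordWeight (u : ℝ) : Real.exp |u| ≤ coordWeight u := by
  have h1 := Real.exp_pos u
  have h2 := Real.exp_pos (-u)
  unfold coordWeight
  rcases abs_choice u with h | h <;> rw [h] <;> linarith

theorem coordWeight_le_two_mul_exp {u b : ℝ} (h : |u| ≤ b) : coordWeight u ≤ 2 * Real.exp b := by
  have h1 : Real.exp u ≤ Real.exp b := Real.exp_le_exp.2 ((le_abs_self u).trans h)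
  have h2 : Real.exp (-u) ≤ Real.exp b := Real.exp_le_exp.2 ((neg_le_abs u).trans h)
  unfold coordWeight
  linarith

/-- The e^{-u} half is the e^u half with h replaced by 1 - h, so the one-dimensional estimates serve
for both. -/
theorem mean_coordWeight_eq (h s t u : ℝ) :
    h * coordWeight (u + s * t) + (1 - h) * coordWeight (u - s * t)
      = Real.exp u * (h * Real.exp (s * t) + (1 - h) * Real.exp (-(s * t)))
        + Real.exp (-u) * ((1 - h) * Real.exp (s * t) + (1 - (1 - h)) * Real.exp (-(s * t))) := by
  simp only [coordWeight, sub_eq_add_neg, neg_add, neg_neg, Real.exp_add]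
  ring

theorem mean_coordWeight_le {h s S t : ℝ} (u : ℝ) (h0 : 0 ≤ h) (h1 : h ≤ 1) (hs : 0 ≤ s)
    (hsS : s ≤ S) :
    h * coordWeight (u + s * t) + (1 - h) * coordWeight (u - s * t)
      ≤ coordWeight u * Real.exp (S * |t|) := by
  rw [mean_coordWeight_eq, coordWeight, add_mul]
  gcongr
  · exact mul_exp_add_mul_exp_neg_le_exp h0 h1 hs hsS
  · exact mul_exp_add_mul_exp_neg_le_exp (by linarith) (by linarith) hs hsS

/-- Only the e^u half has to contract; since e^{-u} ≤ 1, the other half costs just the additive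
term. -/
theorem mean_coordWeight_le_of_nonneg {h s₀ s S η t u : ℝ} (h0 : 0 ≤ h) (h1 : h ≤ 1)
    (hs₀ : 0 ≤ s₀) (hs : s₀ ≤ s) (hsS : s ≤ S) (hη : 0 < η) (hu : 0 ≤ u)
    (hpos : η ≤ t → h ≤ η) (hneg : t ≤ -η → 1 - h ≤ η) :
    h * coordWeight (u + s * t) + (1 - h) * coordWeight (u - s * t)
      ≤ coordWeight u * stepBound s₀ S η t + Real.exp (S * |t|) := by
  rw [mean_coordWeight_eq]
  have e1 := mul_exp_add_mul_exp_neg_le_stepBound h0 h1 hs₀ hs hsS hη hpos hneg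
  have e2 := mul_exp_add_mul_exp_neg_le_exp (h := 1 - h) (t := t) (by linarith) (by linarith)
    (hs₀.trans hs) hsS
  have hle : Real.exp u ≤ coordWeight u := by
    have := Real.exp_pos (-u)
    unfold coordWeight
    linarith
  refine add_le_add ?_ ?_
  · exact (mul_le_mul_of_nonneg_left e1 (Real.exp_pos u).le).trans
      (mul_le_mul_of_nonneg_right hle (stepBound_nonneg hη.le t))
  · refine (mul_le_mul_of_nonneg_left e2 (Real.exp_pos _).le).trans
      (mul_le_of_le_one_left (Real.exp_pos _).le ?_)
    rw [Real.exp_le_one_iff]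
    linarith

theorem mean_coordWeight_le_of_nonpos {h s₀ s S η t u : ℝ} (h0 : 0 ≤ h) (h1 : h ≤ 1)
    (hs₀ : 0 ≤ s₀) (hs : s₀ ≤ s) (hsS : s ≤ S) (hη : 0 < η) (hu : u ≤ 0)
    (hpos : η ≤ t → 1 - h ≤ η) (hneg : t ≤ -η → h ≤ η) :
    h * coordWeight (u + s * t) + (1 - h) * coordWeight (u - s * t)
      ≤ coordWeight u * stepBound s₀ S η t + Real.exp (S * |t|) := by
  -- Reflection u ↦ -u, h ↦ 1 - h, with `coordWeight` even.
  have e := mean_coordWeight_le_of_nonneg (h := 1 - h) (u := -u) (t := t) (by linarith)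
    (by linarith) hs₀ hs hsS hη (by linarith) hpos (by simpa using hneg)
  rw [coordWeight_neg, ← coordWeight_neg (-u + s * t), ← coordWeight_neg (-u - s * t)] at e
  have e1 : -(-u + s * t) = u - s * t := by ring
  have e2 : -(-u - s * t) = u + s * t := by ring
  rw [e1, e2] at e
  linarith

variable {d : ℕ} {Δt : ℝ} {σ : EuclideanSpace ℝ (Fin d) → Matrix (Fin d) (Fin d) ℝ}
  {p : Fin d → EuclideanSpace ℝ (Fin d) → EuclideanSpace ℝ (Fin d) → unitInterval}

/-- The Lyapunov function of the chain. -/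
noncomputable def weight (x : EuclideanSpace ℝ (Fin d)) : ℝ := 1 + ∑ i, coordWeight (x i)

theorem measurable_weight : Measurable (weight (d := d)) := by
  unfold weight
  have := measurable_coordWeight
  fun_prop

theorem one_le_weight (x : EuclideanSpace ℝ (Fin d)) : 1 ≤ weight x :=
  le_add_of_nonneg_right (Finset.sum_nonneg fun _ _ => (coordWeight_pos _).le)

/-- The weight sees the full exponential of the sup norm, so a coordinate of at most half that size
has weight of order √V. The summand 1 in `weight` keeps its logarithm nonnegative, even for d = 0.
-/
theorem exp_supNorm_le_weight (x : EuclideanSpace ℝ (Fin d)) :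
    Real.exp (supNorm x) ≤ weight x := by
  have hw : 0 < weight x := one_pos.trans_le (one_le_weight x)
  rw [← Real.le_log_iff_exp_le hw]
  refine (pi_norm_le_iff_of_nonneg (Real.log_nonneg (one_le_weight x))).2 fun i => ?_
  rw [Real.le_log_iff_exp_le hw]
  have h1 : coordWeight (x i) ≤ ∑ j, coordWeight (x j) :=
    Finset.single_le_sum (f := fun j => coordWeight (x j)) (fun _ _ => (coordWeight_pos _).le)
      (Finset.mem_univ i)
  have h2 := exp_abs_le_coordWeight (x i)
  unfold weight
  exact h2.trans (by linarith)

theorem lintegral_kernel_coordWeight (hσ : ∀ i j, Measurable fun x => σ x i j)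
    (hp : ∀ i, Measurable fun z : EuclideanSpace ℝ (Fin d) × EuclideanSpace ℝ (Fin d) =>
      p i z.1 z.2)
    (hdiag : ∀ i j, i ≠ j → ∀ x, σ x i j = 0) {g : Fin d → EuclideanSpace ℝ (Fin d) → ℝ → ℝ}
    (hg : ∀ i x ν, (p i x ν : ℝ) = g i x (ν i)) (hg01 : ∀ i x t, 0 ≤ g i x t ∧ g i x t ≤ 1)
    (x : EuclideanSpace ℝ (Fin d)) (i : Fin d) :
    ∫⁻ y, ENNReal.ofReal (coordWeight (y i)) ∂kernel Δt σ p hσ hp x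
      = ∫⁻ t, ENNReal.ofReal (g i x t * coordWeight (x i + √Δt * σ x i i * t)
        + (1 - g i x t) * coordWeight (x i - √Δt * σ x i i * t)) ∂gaussianReal 0 1 := by
  rw [lintegral_kernel_apply hσ hp hdiag hg x i (f := fun u => ENNReal.ofReal (coordWeight u))
    measurable_coordWeight.ennreal_ofReal]
  refine lintegral_congr fun t => ?_
  have h0 := (hg01 i x t).1
  have h1 := sub_nonneg.2 (hg01 i x t).2
  rw [ENNReal.ofReal_add (mul_nonneg h0 (coordWeight_pos _).le)
    (mul_nonneg h1 (coordWeight_pos _).le), ENNReal.ofReal_mul h0, ENNReal.ofReal_mul h1]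

theorem lintegral_exp_mul_abs_gaussianReal (S : ℝ) :
    ∫⁻ t, ENNReal.ofReal (Real.exp (S * |t|)) ∂gaussianReal 0 1
      = ENNReal.ofReal (∫ t, Real.exp (S * |t|) ∂gaussianReal 0 1) :=
  (ofReal_integral_eq_lintegral_ofReal (integrable_exp_mul_abs_gaussianReal S)
    (Eventually.of_forall fun _ => (Real.exp_pos _).le)).symm

/-- Far away from the origin the signs of the large coordinates are almost surely chosen so as to
push the chain inwards. -/
theorem exists_forall_norm_lt_flip {μ : EuclideanSpace ℝ (Fin d) → EuclideanSpace ℝ (Fin d)}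
    {g : Fin d → EuclideanSpace ℝ (Fin d) → ℝ → ℝ}
    (hdrift_neg : ∀ i, Tendsto (fun x => μ x i)
      (Bornology.cobounded (EuclideanSpace ℝ (Fin d)) ⊓ 𝓟 {x | x i < -supNorm x / 2}) atTop)
    (hdrift_pos : ∀ i, Tendsto (fun x => μ x i)
      (Bornology.cobounded (EuclideanSpace ℝ (Fin d)) ⊓ 𝓟 {x | supNorm x / 2 < x i}) atBot)
    (hg_one : ∀ i, Tendsto (fun z : EuclideanSpace ℝ (Fin d) × ℝ => g i z.1 z.2)
      (comap (fun z => z.2 * μ z.1 i) atTop) (𝓝 1))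
    (hg_zero : ∀ i, Tendsto (fun z : EuclideanSpace ℝ (Fin d) × ℝ => g i z.1 z.2)
      (comap (fun z => z.2 * μ z.1 i) atBot) (𝓝 0)) {η : ℝ} (hη : 0 < η) :
    ∃ R : ℝ, ∀ x : EuclideanSpace ℝ (Fin d), R < ‖x‖ → ∀ i,
      (supNorm x / 2 < x i → ∀ t, (η ≤ t → g i x t ≤ η) ∧ (t ≤ -η → 1 - g i x t ≤ η)) ∧
      (x i < -supNorm x / 2 → ∀ t, (η ≤ t → 1 - g i x t ≤ η) ∧ (t ≤ -η → g i x t ≤ η)) := by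
  have hT : ∀ i, ∃ T : ℝ, 0 ≤ T ∧ ∀ x t, (T ≤ t * μ x i → 1 - g i x t ≤ η) ∧
      (t * μ x i ≤ -T → g i x t ≤ η) := by
    intro i
    have h1 := (hg_one i).eventually (lt_mem_nhds (by linarith : 1 - η < 1))
    have h2 := (hg_zero i).eventually (gt_mem_nhds hη)
    rw [eventually_comap] at h1 h2
    obtain ⟨T₁, h1⟩ := eventually_atTop.1 h1
    obtain ⟨T₂, h2⟩ := eventually_atBot.1 h2
    refine ⟨max 0 (max T₁ (-T₂)), le_max_left _ _, fun x t => ⟨fun h => ?_, fun h => ?_⟩⟩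
    · have := h1 _ (((le_max_left _ _).trans (le_max_right _ _)).trans h) (x, t) rfl
      linarith
    · have h3 : -T₂ ≤ max 0 (max T₁ (-T₂)) := (le_max_right _ _).trans (le_max_right _ _)
      exact (h2 _ (by linarith) (x, t) rfl).le
  choose T hT0 hT using hT
  -- Once |μ_i| ≥ T_i/η, every |t| ≥ η gives |t μ_i| ≥ T_i, the threshold of the limits of `g`.
  have hev : ∀ᶠ x in Bornology.cobounded (EuclideanSpace ℝ (Fin d)), ∀ i,
      (supNorm x / 2 < x i → μ x i ≤ -(T i / η)) ∧ (x i < -supNorm x / 2 → T i / η ≤ μ x i) := by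
    refine eventually_all.2 fun i => ?_
    have h1 := (hdrift_pos i).eventually (eventually_le_atBot (-(T i / η)))
    have h2 := (hdrift_neg i).eventually (eventually_ge_atTop (T i / η))
    rw [eventually_inf_principal] at h1 h2
    filter_upwards [h1, h2] with x hx1 hx2 using ⟨hx1, hx2⟩
  rw [← comap_norm_atTop, eventually_comap] at hev
  obtain ⟨R, hR'⟩ := eventually_atTop.1 hev
  refine ⟨R, fun x hx i => ?_⟩
  have hR := hR' ‖x‖ hx.le x rfl
  have hd : η * (T i / η) = T i := mul_div_cancel₀ _ hη.ne'
  have hq : 0 ≤ T i / η := div_nonneg (hT0 i) hη.le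
  refine ⟨fun h t => ⟨fun ht => (hT i x t).2 ?_, fun ht => (hT i x t).1 ?_⟩,
    fun h t => ⟨fun ht => (hT i x t).1 ?_, fun ht => (hT i x t).2 ?_⟩⟩
  · have := (hR i).1 h
    nlinarith
  · have := (hR i).1 h
    nlinarith
  · have := (hR i).2 h
    nlinarith
  · have := (hR i).2 h
    nlinarith

/-- Geometric drift towards the origin. -/
theorem exists_drift (hσ : ∀ i j, Measurable fun x => σ x i j)
    (hp : ∀ i, Measurable fun z : EuclideanSpace ℝ (Fin d) × EuclideanSpace ℝ (Fin d) =>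
      p i z.1 z.2)
    (hdiag : ∀ i j, i ≠ j → ∀ x, σ x i j = 0) {s₀ S : ℝ} (hs₀ : 0 < s₀)
    (hs : ∀ i x, s₀ ≤ √Δt * σ x i i ∧ √Δt * σ x i i ≤ S)
    {μ : EuclideanSpace ℝ (Fin d) → EuclideanSpace ℝ (Fin d)}
    {g : Fin d → EuclideanSpace ℝ (Fin d) → ℝ → ℝ}
    (hg : ∀ i x ν, (p i x ν : ℝ) = g i x (ν i))
    (hdrift_neg : ∀ i, Tendsto (fun x => μ x i)
      (Bornology.cobounded (EuclideanSpace ℝ (Fin d)) ⊓ 𝓟 {x | x i < -supNorm x / 2}) atTop)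
    (hdrift_pos : ∀ i, Tendsto (fun x => μ x i)
      (Bornology.cobounded (EuclideanSpace ℝ (Fin d)) ⊓ 𝓟 {x | supNorm x / 2 < x i}) atBot)
    (hg_one : ∀ i, Tendsto (fun z : EuclideanSpace ℝ (Fin d) × ℝ => g i z.1 z.2)
      (comap (fun z => z.2 * μ z.1 i) atTop) (𝓝 1))
    (hg_zero : ∀ i, Tendsto (fun z : EuclideanSpace ℝ (Fin d) × ℝ => g i z.1 z.2)
      (comap (fun z => z.2 * μ z.1 i) atBot) (𝓝 0)) :
    ∃ γ K : ℝ, 0 ≤ γ ∧ γ < 1 ∧ 0 ≤ K ∧ ∀ x, ∫⁻ y, ENNReal.ofReal (weight y)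
      ∂kernel Δt σ p hσ hp x ≤ ENNReal.ofReal (γ * weight x + K) := by
  have hg01 : ∀ i x t, 0 ≤ g i x t ∧ g i x t ≤ 1 := by
    intro i x t
    have := hg i x (WithLp.toLp 2 fun _ => t)
    simp only at this
    rw [← this]
    exact (p i x _).2
  obtain ⟨η, hη, q, hq0, hq1, hq⟩ := exists_lintegral_stepBound_le hs₀ S
  obtain ⟨R, hR⟩ := exists_forall_norm_lt_flip hdrift_neg hdrift_pos hg_one hg_zero hη
  set L : ℝ := ∫ t, Real.exp (S * |t|) ∂gaussianReal 0 1 with hL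
  have hL0 : 0 ≤ L := integral_nonneg fun t => (Real.exp_pos _).le
  have hLeq := lintegral_exp_mul_abs_gaussianReal S
  have hcrude : ∀ x i, ∫⁻ y, ENNReal.ofReal (coordWeight (y i)) ∂kernel Δt σ p hσ hp x
      ≤ ENNReal.ofReal (coordWeight (x i) * L) := by
    intro x i
    rw [lintegral_kernel_coordWeight hσ hp hdiag hg hg01 x i,
      ENNReal.ofReal_mul (coordWeight_pos _).le, hL, ← hLeq,
      ← lintegral_const_mul _ (by fun_prop)]
    refine lintegral_mono fun t => ?_
    rw [← ENNReal.ofReal_mul (coordWeight_pos _).le]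
    exact ENNReal.ofReal_le_ofReal (mean_coordWeight_le _ (hg01 i x t).1 (hg01 i x t).2
      (hs₀.le.trans (hs i x).1) (hs i x).2)
  have hfine : ∀ x i, (∀ t, g i x t * coordWeight (x i + √Δt * σ x i i * t)
        + (1 - g i x t) * coordWeight (x i - √Δt * σ x i i * t)
          ≤ coordWeight (x i) * stepBound s₀ S η t + Real.exp (S * |t|)) →
      ∫⁻ y, ENNReal.ofReal (coordWeight (y i)) ∂kernel Δt σ p hσ hp x
        ≤ ENNReal.ofReal (q * coordWeight (x i) + L) := by
    intro x i h
    have hw := (coordWeight_pos (x i)).le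
    rw [lintegral_kernel_coordWeight hσ hp hdiag hg hg01 x i]
    calc _ ≤ ∫⁻ t, (ENNReal.ofReal (coordWeight (x i)) * ENNReal.ofReal (stepBound s₀ S η t)
              + ENNReal.ofReal (Real.exp (S * |t|))) ∂gaussianReal 0 1 := by
          refine lintegral_mono fun t => ?_
          rw [← ENNReal.ofReal_mul hw, ← ENNReal.ofReal_add
            (mul_nonneg hw (stepBound_nonneg hη.le t)) (Real.exp_pos _).le]
          exact ENNReal.ofReal_le_ofReal (h t)
      _ = ENNReal.ofReal (coordWeight (x i))
            * ∫⁻ t, ENNReal.ofReal (stepBound s₀ S η t) ∂gaussianReal 0 1 + ENNReal.ofReal L := by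
          rw [lintegral_add_right _ (by fun_prop), hLeq,
            lintegral_const_mul _ (measurable_stepBound _ _ _).ennreal_ofReal]
      _ ≤ ENNReal.ofReal (coordWeight (x i)) * ENNReal.ofReal q + ENNReal.ofReal L := by gcongr
      _ = _ := by
          rw [← ENNReal.ofReal_mul hw, ← ENNReal.ofReal_add (mul_nonneg hw hq0) hL0, mul_comm q]
  -- One bound for all regimes: the |R| term covers bounded x, the q term large coordinates, and the
  -- last term coordinates of size at most half the sup norm.
  have hcoord : ∀ x i, ∫⁻ y, ENNReal.ofReal (coordWeight (y i)) ∂kernel Δt σ p hσ hp x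
      ≤ ENNReal.ofReal (q * coordWeight (x i) + L + 2 * L * Real.exp |R|
        + 2 * L * Real.exp (supNorm x / 2)) := by
    intro x i
    have hw := coordWeight_pos (x i)
    have e1 : 0 ≤ q * coordWeight (x i) := by positivity
    have e2 : 0 ≤ 2 * L * Real.exp |R| := by positivity
    have e3 : 0 ≤ 2 * L * Real.exp (supNorm x / 2) := by positivity
    rcases le_or_gt ‖x‖ R with hx | hx
    · refine (hcrude x i).trans (ENNReal.ofReal_le_ofReal ?_)
      have hxi : |x i| ≤ |R| := (PiLp.norm_apply_le x i).trans (hx.trans (le_abs_self R))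
      have := mul_le_mul_of_nonneg_right (coordWeight_le_two_mul_exp hxi) hL0
      linarith
    rcases lt_or_ge (supNorm x / 2) (x i) with hpos | hpos
    · refine (hfine x i fun t => ?_).trans (ENNReal.ofReal_le_ofReal (by linarith))
      have hxi : 0 ≤ x i := by linarith [supNorm_nonneg x]
      exact mean_coordWeight_le_of_nonneg (hg01 i x t).1 (hg01 i x t).2 hs₀.le (hs i x).1
        (hs i x).2 hη hxi ((hR x hx i).1 hpos t).1 ((hR x hx i).1 hpos t).2
    rcases lt_or_ge (x i) (-supNorm x / 2) with hneg | hneg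
    · refine (hfine x i fun t => ?_).trans (ENNReal.ofReal_le_ofReal (by linarith))
      have hxi : x i ≤ 0 := by linarith [supNorm_nonneg x]
      exact mean_coordWeight_le_of_nonpos (hg01 i x t).1 (hg01 i x t).2 hs₀.le (hs i x).1
        (hs i x).2 hη hxi ((hR x hx i).2 hneg t).1 ((hR x hx i).2 hneg t).2
    · refine (hcrude x i).trans (ENNReal.ofReal_le_ofReal ?_)
      have hxi : |x i| ≤ supNorm x / 2 := abs_le.2 ⟨by linarith, hpos⟩
      have := mul_le_mul_of_nonneg_right (coordWeight_le_two_mul_exp hxi) hL0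
      linarith
  -- Each of the d coordinates costs δV, so dδ must stay below 1 - q; d + 1 admits d = 0.
  set δ : ℝ := (1 - q) / (2 * (d + 1)) with hδ
  have hδ0 : 0 < δ := div_pos (by linarith) (by positivity)
  have hδ1 : d * δ < 1 - q := by
    have h1 : δ * (2 * (d + 1)) = 1 - q := div_mul_cancel₀ _ (by positivity)
    have h2 : 0 ≤ d * δ := by positivity
    linarith
  set K₁ : ℝ := L + 2 * L * Real.exp |R| + L ^ 2 / δ with hK₁
  have hK₁0 : 0 ≤ K₁ := by positivity
  refine ⟨q + d * δ, 1 + d * K₁, by positivity, by linarith, by positivity, fun x => ?_⟩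
  -- Young: 2La ≤ δa² + L²/δ with a = e^{‖x‖_∞/2}, where a² ≤ V.
  have hyoung : 2 * L * Real.exp (supNorm x / 2) ≤ δ * weight x + L ^ 2 / δ := by
    have h1 := exp_supNorm_le_weight x
    have h2 : Real.exp (supNorm x) = Real.exp (supNorm x / 2) ^ 2 := by
      rw [← Real.exp_nat_mul]; push_cast; congr 1; ring
    have h3 : δ * (L / δ) ^ 2 = L ^ 2 / δ := by field_simp
    have h4 : δ * (L / δ) = L := mul_div_cancel₀ _ hδ0.ne'
    have h5 : 0 ≤ δ * (Real.exp (supNorm x / 2) - L / δ) ^ 2 := by positivity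
    have h6 : δ * (Real.exp (supNorm x / 2) - L / δ) ^ 2 = δ * Real.exp (supNorm x / 2) ^ 2
        - 2 * Real.exp (supNorm x / 2) * (δ * (L / δ)) + δ * (L / δ) ^ 2 := by
      generalize L / δ = w
      ring
    rw [h6, h3, h4] at h5
    have h7 : δ * Real.exp (supNorm x / 2) ^ 2 ≤ δ * weight x := by rw [← h2]; gcongr
    linarith
  have hw1 := one_le_weight x
  have hsumle : ∑ i, (q * coordWeight (x i) + (K₁ + δ * weight x)) + 1
      ≤ (q + d * δ) * weight x + (1 + d * K₁) := by
    rw [Finset.sum_add_distrib, ← Finset.mul_sum]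
    simp only [Finset.sum_const, Finset.card_univ, Fintype.card_fin, nsmul_eq_mul]
    have : weight x = 1 + ∑ i, coordWeight (x i) := rfl
    nlinarith
  refine le_trans ?_ (ENNReal.ofReal_le_ofReal hsumle)
  have hterm : ∀ i, 0 ≤ q * coordWeight (x i) + (K₁ + δ * weight x) := fun i => by
    have := coordWeight_pos (x i)
    positivity
  calc ∫⁻ y, ENNReal.ofReal (weight y) ∂kernel Δt σ p hσ hp x
      = ∫⁻ y, (∑ i, ENNReal.ofReal (coordWeight (y i)) + 1) ∂kernel Δt σ p hσ hp x := by
        refine lintegral_congr fun y => ?_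
        rw [weight, ENNReal.ofReal_add zero_le_one
          (Finset.sum_nonneg fun _ _ => (coordWeight_pos _).le),
          ENNReal.ofReal_sum_of_nonneg fun _ _ => (coordWeight_pos _).le, ENNReal.ofReal_one,
          add_comm]
    _ = ∑ i, ∫⁻ y, ENNReal.ofReal (coordWeight (y i)) ∂kernel Δt σ p hσ hp x + 1 := by
        rw [lintegral_add_right _ measurable_const, lintegral_finsetSum]
        · simp
        · have := measurable_coordWeight
          fun_prop
    _ ≤ ∑ i, ENNReal.ofReal (q * coordWeight (x i) + (K₁ + δ * weight x)) + 1 := by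
        gcongr with i _
        refine (hcoord x i).trans (ENNReal.ofReal_le_ofReal ?_)
        simp only [hK₁]
        linarith
    _ = ENNReal.ofReal (∑ i, (q * coordWeight (x i) + (K₁ + δ * weight x)) + 1) := by
        rw [ENNReal.ofReal_add (Finset.sum_nonneg fun i _ => hterm i) zero_le_one,
          ENNReal.ofReal_sum_of_nonneg fun i _ => hterm i, ENNReal.ofReal_one]

theorem norm_pow_le_mul_weight (k : ℕ) (x : EuclideanSpace ℝ (Fin d)) :
    ‖x‖ ^ k ≤ (d : ℝ) ^ k * k.factorial * weight x := by
  have h0 := supNorm_nonneg x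
  have h1 : supNorm x ^ k ≤ k.factorial * Real.exp (supNorm x) := by
    have := Real.pow_div_factorial_le_exp (supNorm x) h0 k
    rw [div_le_iff₀ (by positivity)] at this
    linarith
  calc ‖x‖ ^ k ≤ (d * supNorm x) ^ k := by gcongr; exact norm_le_mul_supNorm x
    _ = d ^ k * supNorm x ^ k := mul_pow _ _ _
    _ ≤ d ^ k * (k.factorial * weight x) := by
        gcongr
        exact h1.trans (by gcongr; exact exp_supNorm_le_weight x)
    _ = _ := by ring

end Drift

end SkewSymmetric

/-! ### Geometric ergodicity of the skew-symmetric scheme -/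

theorem theorem4p2 {d : ℕ} (Δt : ℝ) (hΔt : 0 < Δt)
    (μ : EuclideanSpace ℝ (Fin d) → EuclideanSpace ℝ (Fin d))
    (σ : EuclideanSpace ℝ (Fin d) → Matrix (Fin d) (Fin d) ℝ)
    (p : Fin d → EuclideanSpace ℝ (Fin d) → EuclideanSpace ℝ (Fin d) → unitInterval)
    (hσ : ∀ i j, Measurable fun x => σ x i j)
    (hp : ∀ i, Measurable fun z : EuclideanSpace ℝ (Fin d) × EuclideanSpace ℝ (Fin d) =>
      p i z.1 z.2)
    (hp01 : ∀ i x ν, 0 < p i x ν ∧ p i x ν < 1)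
    -- the volatility is diagonal, and bounded above and below
    (hdiag : ∀ i j, i ≠ j → ∀ x, σ x i j = 0)
    (N M : ℝ) (hN : 0 < N) (hNM : N < M)
    (hbound : ∀ i x, N ≤ σ x i i ∧ σ x i i ≤ M)
    -- the drift components are coordinatewise confining
    (hdrift_neg : ∀ i, Filter.Tendsto (fun x => μ x i)
      (Bornology.cobounded (EuclideanSpace ℝ (Fin d)) ⊓
        Filter.principal {x | x i < -SkewSymmetric.supNorm x / 2}) Filter.atTop)
    (hdrift_pos : ∀ i, Filter.Tendsto (fun x => μ x i)
      (Bornology.cobounded (EuclideanSpace ℝ (Fin d)) ⊓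
        Filter.principal {x | SkewSymmetric.supNorm x / 2 < x i}) Filter.atBot)
    -- `p i` depends on `ν` only through `ν i`, with the stated limits
    (g : Fin d → EuclideanSpace ℝ (Fin d) → ℝ → ℝ)
    (hg : ∀ i x ν, (p i x ν : ℝ) = g i x (ν i))
    (hg_compact : ∀ i, ∀ K : Set (EuclideanSpace ℝ (Fin d) × ℝ), IsCompact K →
      ∃ ε > 0, ∀ z ∈ K, ε ≤ g i z.1 z.2)
    (hg_one : ∀ i, Filter.Tendsto (fun z : EuclideanSpace ℝ (Fin d) × ℝ => g i z.1 z.2)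
      (Filter.comap (fun z => z.2 * μ z.1 i) Filter.atTop) (nhds 1))
    (hg_zero : ∀ i, Filter.Tendsto (fun z : EuclideanSpace ℝ (Fin d) × ℝ => g i z.1 z.2)
      (Filter.comap (fun z => z.2 * μ z.1 i) Filter.atBot) (nhds 0)) :
    ∃ (π : MeasureTheory.Measure (EuclideanSpace ℝ (Fin d)))
      (_ : MeasureTheory.IsProbabilityMeasure π),
      (SkewSymmetric.kernel Δt σ p hσ hp).Invariant π ∧
      (∀ k : ℕ, MeasureTheory.Integrable (fun x => ‖x‖ ^ k) π) ∧
      ∃ (C lam : ℝ) (V : EuclideanSpace ℝ (Fin d) → ℝ),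
        0 < C ∧ 0 < lam ∧ (∀ x, 1 ≤ V x) ∧
        ∀ (n : ℕ) (x : EuclideanSpace ℝ (Fin d)),
          SkewSymmetric.tvNorm ((SkewSymmetric.kernel Δt σ p hσ hp ^ n) x) π
            ≤ C * V x * Real.exp (-lam * n) := by
  have hΔ : 0 < √Δt := Real.sqrt_pos.2 hΔt
  have hs₀ : 0 < √Δt * N := mul_pos hΔ hN
  have hs : ∀ i x, √Δt * N ≤ √Δt * σ x i i ∧ √Δt * σ x i i ≤ √Δt * M := fun i x =>
    ⟨mul_le_mul_of_nonneg_left (hbound i x).1 hΔ.le,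
      mul_le_mul_of_nonneg_left (hbound i x).2 hΔ.le⟩
  obtain ⟨γ, K, hγ0, hγ1, hK, hdrift⟩ := SkewSymmetric.exists_drift hσ hp hdiag hs₀ hs hg
    hdrift_neg hdrift_pos hg_one hg_zero
  have hW0 : ∀ x : EuclideanSpace ℝ (Fin d), 0 ≤ SkewSymmetric.weight x := fun x =>
    zero_le_one.trans (SkewSymmetric.one_le_weight x)
  obtain ⟨π, hπ, hinv, hint, C, lam, hC, hlam, hrate⟩ :=
    SkewSymmetric.exists_invariant_tvNorm_le_of_drift_of_minorization
      (P := SkewSymmetric.kernel Δt σ p hσ hp) SkewSymmetric.measurable_weight hW0 hγ0 hγ1 hK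
      hdrift fun R => by
        obtain ⟨η, hfin, hne, hη⟩ :=
          SkewSymmetric.exists_minorization hσ hp hdiag hs₀ hs hg hg_compact R
        refine ⟨η, hfin, hne, fun x hx => hη x ?_⟩
        have h1 := Real.add_one_le_exp (SkewSymmetric.supNorm x)
        have h2 := SkewSymmetric.exp_supNorm_le_weight x
        linarith
  refine ⟨π, hπ, hinv, fun k => ?_, C, lam, fun x => 1 + SkewSymmetric.weight x, hC, hlam,
    fun x => le_add_of_nonneg_right (hW0 x), hrate⟩
  refine (hint.const_mul ((d : ℝ) ^ k * k.factorial)).mono'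
    (by fun_prop) (Filter.Eventually.of_forall fun x => ?_)
  rw [Real.norm_of_nonneg (by positivity)]
  exact SkewSymmetric.norm_pow_le_mul_weight k x
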